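/- **Data model.** Fix a countably infinite set $\mathbf{dom}$ of atomic values. *Values* and *paths* are defined by mutual induction: every atomic value is a value, every finite sequence of values is a path (the empty path is allowed), and for every path $p$ the packed value $\langle p\rangle$ is a value; a value is identified with the path of length one. A *schema* is a finite set of relation names with arities (infinitely many names of each arity are available); an *instance* of a schema $\Gamma$ assigns to each $n$-ary $R\in\Gamma$ a finite set of $n$-tuples of paths. *Path expressions* are built from atomic values, atomic variables (ranging over $\mathbf{dom}$) and path variables (ranging over paths) by packing $\langle\cdot\rangle$ and finite (possibly empty) concatenation. **Sequence Datalog.** An *atom* is a predicate $R(e_1,\dots,e_n)$ or an equation $e_1=e_2$ between path expressions. A *rule* consists of a head predicate and a finite body of atoms and negated atoms. It must be *safe*: all its variables are limited, where the variables of positive body predicates are limited, and if all variables of one side of a positive body equation are limited then so are those of the other side. A *program* is a finite sequence of strata, which are finite sets of safe rules, such that a relation name occurring in a negated predicate in some stratum is not the head of a rule in that or a later stratum. The *IDB* names are those occurring in heads, the *EDB* names the other names that occur; the program is *over* $\Gamma$ if its EDB names belong to $\Gamma$ and its IDB names do not. It is *nonrecursive* if the graph on the IDB names, with an edge from $R_1$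 to $R_2$ whenever $R_2$ occurs (possibly negated) in the body of a rule with head $R_1$, has no cycle. For an instance $I$ of $\Gamma$, $P(I)$ is obtained by applying the strata in order; applying a stratum to an instance yields the smallest (finite) instance that contains it, agrees with it on all names that are not heads of the stratum, and satisfies all rules of the stratum. **Sequence relational algebra.** Expressions over $\Gamma$ are built from the relation names in $\Gamma$ and finite constant relations by union, difference, cartesian product and the following operators on $n$-ary relations $R$, where $\alpha,\beta,\alpha_1,\dots,\alpha_p$ are path expressions over the path variables $\$1,\dots,\$n$, $t(\alpha)$ results from $\alpha$ by substituting $t_i$ for each $\$i$, and $i\in\{1,\dots,n\}$: $$\sigma_{\alpha=\beta}(R)=\{t\in R\mid t(\alpha)=t(\beta)\},\qquad \pi_{\alpha_1,\dots,\alpha_p}(R)=\{(t(\alpha_1),\dots,t(\alpha_p))\mid t\in R\},$$ $$\mathit{UNPACK}_i(R)=\{(t_1,\dots,t_{i-1},s,t_{i+1},\dots,t_n)\mid (t_1,\dots,t_{i-1},\langle s\rangle,t_{i+1},\dots,t_n)\in R\},$$ $$\mathit{SUB}_i(R)=\{(t_1,\dots,t_n,s)\mid (t_1,\dots,t_n)\in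 R,\ s \text{ is a (contiguous, possibly empty) substring of } t_i\}.$$ **Theorem.** Let $\Gamma$ be a schema. 1. For every nonrecursive Sequence Datalog program $P$ over $\Gamma$ and every IDB relation name $T$ of $P$, there is a sequence relational algebra expression $E$ over $\Gamma$ such that, for every instance $I$ of $\Gamma$, $P(I)$ is defined and $P(I)(T)=E(I)$. 2. Conversely, for every sequence relational algebra expression $E$ over $\Gamma$ there are a nonrecursive Sequence Datalog program $P$ over $\Gamma$ and an IDB relation name $T$ of $P$, of the same arity as $E$, such that, for every instance $I$ of $\Gamma$, $P(I)$ is defined and $P(I)(T)=E(I)$. -/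

import Mathlib

namespace SeqDatalog

universe u

/-! ### Data model -/

/-- Values over the universe `D` of atomic values: atomic values and packed values `⟨p⟩`, where `p`
is a path, that is, a finite sequence of values. -/
inductive Value (D : Type u) : Type u
  | atom : D → Value D
  | pack : List (Value D) → Value D

/-- Paths: finite sequences of values. A value is identified with the corresponding path of
length one. -/
abbrev Path (D : Type u) : Type u := List (Value D)

/-- Relation names with their arities; each arity has an infinite supply of names. -/
structure RelName where
  id : ℕ
  arity : ℕ

/-- A schema is a finite set of relation names. -/
abbrev Schema : Type := Finset RelName

/-- `n`-tuples of paths. -/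
abbrev Tuple (D : Type u) (n : ℕ) : Type u := Fin n → Path D

/-- An assignment of finite relations on paths to relation names. The instances of a schema `Γ`
are those with `I.Over Γ`: relation names outside `Γ` carry no facts. -/
@[ext]
structure Instance (D : Type u) where
  rel : (R : RelName) → Set (Tuple D R.arity)
  finite : ∀ R, (rel R).Finite

/-- `I` is an instance of the schema `Γ`. -/
def Instance.Over {D : Type u} (I : Instance D) (Γ : Schema) : Prop :=
  ∀ R, R ∉ Γ → I.rel R = ∅

/-- Instances are ordered by inclusion of their sets of facts. -/
instance {D : Type u} : PartialOrder (Instance D) where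
  le I J := ∀ R, I.rel R ⊆ J.rel R
  le_refl _ _ := subset_rfl
  le_trans _ _ _ h k R := (h R).trans (k R)
  le_antisymm _ _ h k := Instance.ext (funext fun R => (h R).antisymm (k R))

/-! ### Path expressions -/

/-- Path expressions with atomic variables from `A` and path variables from `X`. Finite sequences
are built from the empty sequence and concatenation. -/
inductive PathExpr (D : Type u) (A X : Type) : Type u
  | const : D → PathExpr D A X
  | avar : A → PathExpr D A X
  | pvar : X → PathExpr D A X
  | pack : PathExpr D A X → PathExpr D A X
  | empty : PathExpr D A X
  | concat : PathExpr D A X → PathExpr D A X → PathExpr D A X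

namespace PathExpr

variable {D : Type u} {A X : Type}

/-- The path `ν(e)`, for the valuation `ν` that is `f` on atomic variables and `g` on path
variables. -/
def eval (f : A → D) (g : X → Path D) : PathExpr D A X → Path D
  | const a => [Value.atom a]
  | avar x => [Value.atom (f x)]
  | pvar x => g x
  | pack e => [Value.pack (e.eval f g)]
  | empty => []
  | concat e₁ e₂ => e₁.eval f g ++ e₂.eval f g

/-- The variables occurring in a path expression; `Sum.inl` marks atomic variables and `Sum.inr`
path variables. -/
def vars : PathExpr D A X → Set (A ⊕ X)
  | const _ => ∅
  | avar x => {Sum.inl x}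
  | pvar x => {Sum.inr x}
  | pack e => e.vars
  | empty => ∅
  | concat e₁ e₂ => e₁.vars ∪ e₂.vars

end PathExpr

/-! ### Syntax of Sequence Datalog -/

/-- Variables of Sequence Datalog: `Sum.inl` for atomic and `Sum.inr` for path variables. -/
abbrev Var : Type := ℕ ⊕ ℕ

/-- Path expressions of Sequence Datalog. -/
abbrev Expr (D : Type u) : Type u := PathExpr D ℕ ℕ

/-- Predicates `R(e₁, …, eₙ)`. -/
structure Predicate (D : Type u) where
  name : RelName
  args : Fin name.arity → Expr D

/-- Atoms: predicates and equations. -/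
inductive Atom (D : Type u) : Type u
  | pred : Predicate D → Atom D
  | eqn : Expr D → Expr D → Atom D

/-- Literals: atoms and negated atoms. -/
inductive Literal (D : Type u) : Type u
  | pos : Atom D → Literal D
  | neg : Atom D → Literal D

/-- Rules `head ← body`. Only membership in the list `body` matters. -/
structure Rule (D : Type u) where
  head : Predicate D
  body : List (Literal D)

variable {D : Type u}

def Predicate.vars (p : Predicate D) : Set Var := ⋃ i, (p.args i).vars

def Atom.vars : Atom D → Set Var
  | pred p => p.vars
  | eqn e₁ e₂ => e₁.vars ∪ e₂.vars

def Literal.atom : Literal D → Atom D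
  | pos a => a
  | neg a => a

def Rule.vars (r : Rule D) : Set Var := r.head.vars ∪ {v | ∃ L ∈ r.body, v ∈ L.atom.vars}

/-- The limited variables of a rule. -/
inductive Rule.Limited (r : Rule D) : Var → Prop
  | ofPred (p : Predicate D) (v : Var) :
      Literal.pos (Atom.pred p) ∈ r.body → v ∈ p.vars → Rule.Limited r v
  | ofLeft (e₁ e₂ : Expr D) (v : Var) :
      Literal.pos (Atom.eqn e₁ e₂) ∈ r.body → (∀ w ∈ e₁.vars, Rule.Limited r w) →
        v ∈ e₂.vars → Rule.Limited r v
  | ofRight (e₁ e₂ : Expr D) (v : Var) :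
      Literal.pos (Atom.eqn e₁ e₂) ∈ r.body → (∀ w ∈ e₂.vars, Rule.Limited r w) →
        v ∈ e₁.vars → Rule.Limited r v

/-- A rule is safe if all its variables are limited. -/
def Rule.Safe (r : Rule D) : Prop := ∀ v ∈ r.vars, r.Limited v

/-- A relation name occurs, positively or negated, in the body of a rule. -/
def Rule.Uses (r : Rule D) (R : RelName) : Prop :=
  ∃ L ∈ r.body, ∃ p : Predicate D, L.atom = Atom.pred p ∧ p.name = R

/-- A stratum is a finite set of rules, given as a list. -/
abbrev Stratum (D : Type u) : Type u := List (Rule D)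

/-- The relation names used in heads of rules of a stratum. -/
def Stratum.heads (S : Stratum D) : Set RelName := {R | ∃ r ∈ S, r.head.name = R}

/-- Stratified negation: if a negated predicate on `R` occurs in a stratum, then no rule in that
stratum or in a later one has `R` in its head. -/
def Stratified : List (Stratum D) → Prop
  | [] => True
  | S :: rest =>
      (∀ r ∈ S, ∀ p : Predicate D, Literal.neg (Atom.pred p) ∈ r.body →
        ∀ S' ∈ S :: rest, p.name ∉ Stratum.heads S') ∧ Stratified rest

/-- Sequence Datalog programs. -/
structure Program (D : Type u) where
  strata : List (Stratum D)
  safe : ∀ S ∈ strata, ∀ r ∈ S, r.Safe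
  stratified : Stratified strata

/-- `r` is one of the rules of `P`. -/
def Program.HasRule (P : Program D) (r : Rule D) : Prop := ∃ S ∈ P.strata, r ∈ S

/-- IDB relation names: those used in the head of some rule. -/
def Program.idb (P : Program D) : Set RelName := {R | ∃ r, P.HasRule r ∧ r.head.name = R}

/-- EDB relation names: the other relation names occurring in the program. -/
def Program.edb (P : Program D) : Set RelName := {R | (∃ r, P.HasRule r ∧ r.Uses R) ∧ R ∉ P.idb}

/-- `P` is a program over the schema `Γ`. -/
def Program.Over (P : Program D) (Γ : Schema) : Prop :=
  (∀ R ∈ P.edb, R ∈ Γ) ∧ ∀ R ∈ P.idb, R ∉ Γ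

/-- Edges of the dependency graph, whose nodes are the IDB relation names. -/
def Program.DependsOn (P : Program D) (R₁ R₂ : RelName) : Prop :=
  R₁ ∈ P.idb ∧ R₂ ∈ P.idb ∧ ∃ r, P.HasRule r ∧ r.head.name = R₁ ∧ r.Uses R₂

/-- A program is nonrecursive if its dependency graph has no cycle (loops are cycles). -/
def Program.Nonrecursive (P : Program D) : Prop :=
  ∀ R, ¬ Relation.TransGen P.DependsOn R R

/-! ### Semantics of Sequence Datalog -/

/-- Valuations. -/
structure Valuation (D : Type u) where
  onAtomic : ℕ → D
  onPath : ℕ → Path D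

/-- The path `ν(e)`. -/
def Valuation.apply (ν : Valuation D) (e : Expr D) : Path D := e.eval ν.onAtomic ν.onPath

/-- `I, ν` satisfies the predicate `p`: the fact `ν(p)` is in `I`. -/
def Predicate.Sat (I : Instance D) (ν : Valuation D) (p : Predicate D) : Prop :=
  (fun i => ν.apply (p.args i)) ∈ I.rel p.name

def Atom.Sat (I : Instance D) (ν : Valuation D) : Atom D → Prop
  | pred p => p.Sat I ν
  | eqn e₁ e₂ => ν.apply e₁ = ν.apply e₂

def Literal.Sat (I : Instance D) (ν : Valuation D) : Literal D → Prop
  | pos a => a.Sat I ν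
  | neg a => ¬ a.Sat I ν

/-- The rule `r` is satisfied in `I`. -/
def Rule.SatisfiedIn (r : Rule D) (I : Instance D) : Prop :=
  ∀ ν : Valuation D, (∀ L ∈ r.body, L.Sat I ν) → r.head.Sat I ν

/-- `J` is the result of applying the stratum `S` to `I`: the smallest instance that contains `I`,
agrees with `I` on all relation names that are not heads of `S`, and satisfies the rules of `S`.
(If `I` has no facts on the heads of `S`, then the inclusion of `I` follows from the agreement.) -/
def Stratum.IsResult (S : Stratum D) (I J : Instance D) : Prop :=
  IsLeast {K : Instance D | I ≤ K ∧ (∀ R, R ∉ S.heads → K.rel R = I.rel R) ∧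
    ∀ r ∈ S, r.SatisfiedIn K} J

/-- `J` results from `I` by applying the strata one after the other. -/
def StrataResult : List (Stratum D) → Instance D → Instance D → Prop
  | [], I, J => J = I
  | S :: rest, I, J => ∃ K, Stratum.IsResult S I K ∧ StrataResult rest K J

/-- `P(I)` is defined and equal to `J`. -/
def Program.IsResult (P : Program D) (I J : Instance D) : Prop := StrataResult P.strata I J

theorem StrataResult.unique : ∀ {Q : List (Stratum D)} {I J J' : Instance D},
    StrataResult Q I J → StrataResult Q I J' → J = J'
  | [], _, _, _, h, h' => h.trans h'.symm
  | _ :: _, _, _, _, ⟨_, hK, h⟩, ⟨_, hK', h'⟩ => by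
    cases IsLeast.unique hK hK'
    exact StrataResult.unique h h'

/-- The result `P(I)` is unique. -/
theorem Program.IsResult.unique {P : Program D} {I J J' : Instance D}
    (h : P.IsResult I J) (h' : P.IsResult I J') : J = J' :=
  StrataResult.unique h h'

/-! ### Sequence relational algebra -/

/-- Path expressions over the path variables `$1, …, $n`. -/
abbrev ColExpr (D : Type u) (n : ℕ) : Type u := PathExpr D Empty (Fin n)

/-- The path `t(α)`, where `t` is viewed as the valuation that maps `$i` to `tᵢ`. -/
def ColExpr.apply {n : ℕ} (t : Tuple D n) (α : ColExpr D n) : Path D :=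
  PathExpr.eval (fun x => x.elim) t α

/-- Sequence relational algebra expressions over `Γ`, indexed by the arity of their result. -/
inductive AlgExpr (D : Type u) (Γ : Schema) : ℕ → Type u
  | rel (R : RelName) : R ∈ Γ → AlgExpr D Γ R.arity
  | const {n : ℕ} : Finset (Tuple D n) → AlgExpr D Γ n
  | union {n : ℕ} : AlgExpr D Γ n → AlgExpr D Γ n → AlgExpr D Γ n
  | diff {n : ℕ} : AlgExpr D Γ n → AlgExpr D Γ n → AlgExpr D Γ n
  | prod {m n : ℕ} : AlgExpr D Γ m → AlgExpr D Γ n → AlgExpr D Γ (m + n)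
  | select {n : ℕ} : ColExpr D n → ColExpr D n → AlgExpr D Γ n → AlgExpr D Γ n
  | project {n p : ℕ} : (Fin p → ColExpr D n) → AlgExpr D Γ n → AlgExpr D Γ p
  | unpack {n : ℕ} : Fin n → AlgExpr D Γ n → AlgExpr D Γ n
  | sub {n : ℕ} : Fin n → AlgExpr D Γ n → AlgExpr D Γ (n + 1)

/-- The relation `E(I)`. Substrings are contiguous: `s <:+: p` says `p = u ++ s ++ v` for some
`u`, `v`. -/
def AlgExpr.eval {Γ : Schema} (I : Instance D) : {n : ℕ} → AlgExpr D Γ n → Set (Tuple D n)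
  | _, .rel R _ => I.rel R
  | _, .const C => {t | t ∈ C}
  | _, .union E F => E.eval I ∪ F.eval I
  | _, .diff E F => E.eval I \ F.eval I
  | _, .prod E F => {u | ∃ s ∈ E.eval I, ∃ t ∈ F.eval I, u = Fin.append s t}
  | _, .select α β E => {t | t ∈ E.eval I ∧ α.apply t = β.apply t}
  | _, .project α E => {u | ∃ t ∈ E.eval I, u = fun j => (α j).apply t}
  | _, .unpack i E =>
      {u | ∃ t ∈ E.eval I, ∃ s : Path D, t i = [Value.pack s] ∧ u = Function.update t i s}
  | _, .sub i E =>
      {u | ∃ t ∈ E.eval I, ∃ s : Path D, s <:+: t i ∧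
        u = Fin.snoc (α := fun _ => Path D) t s}

end SeqDatalog

namespace SeqDatalog

universe u

variable {D : Type u} {Γ : Schema}

/-! ### Substitution in path expressions -/

namespace PathExpr

variable {A B X Y : Type}

/-- The value of a variable under the valuation given by `f` and `g`. -/
def varVal (f : A → D) (g : X → Path D) : A ⊕ X → Path D :=
  Sum.elim (fun a => [Value.atom (f a)]) g

/-- Simultaneous substitution of path expressions for variables. -/
def subst (s : A ⊕ X → PathExpr D B Y) : PathExpr D A X → PathExpr D B Y
  | const a => const a
  | avar x => s (Sum.inl x)
  | pvar x => s (Sum.inr x)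
  | pack e => pack (e.subst s)
  | empty => empty
  | concat e₁ e₂ => concat (e₁.subst s) (e₂.subst s)

theorem eval_subst {f : A → D} {g : X → Path D} {f' : B → D} {g' : Y → Path D}
    {s : A ⊕ X → PathExpr D B Y} {e : PathExpr D A X}
    (h : ∀ v ∈ e.vars, (s v).eval f' g' = varVal f g v) :
    (e.subst s).eval f' g' = e.eval f g := by
  induction e with
  | const a => rfl
  | avar x => exact h (Sum.inl x) rfl
  | pvar x => exact h (Sum.inr x) rfl
  | pack e ih => simp only [subst, eval, ih h]
  | empty => rfl
  | concat e₁ e₂ ih₁ ih₂ =>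
    simp only [subst, eval, ih₁ fun v hv => h v (Or.inl hv), ih₂ fun v hv => h v (Or.inr hv)]

theorem eval_congr {f f' : A → D} {g g' : X → Path D} {e : PathExpr D A X}
    (h : ∀ v ∈ e.vars, varVal f g v = varVal f' g' v) : e.eval f g = e.eval f' g' := by
  induction e with
  | const a => rfl
  | avar x => exact h (Sum.inl x) rfl
  | pvar x => exact h (Sum.inr x) rfl
  | pack e ih => simp only [eval, ih h]
  | empty => rfl
  | concat e₁ e₂ ih₁ ih₂ =>
    simp only [eval, ih₁ fun v hv => h v (Or.inl hv), ih₂ fun v hv => h v (Or.inr hv)]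

theorem finite_vars (e : PathExpr D A X) : e.vars.Finite := by
  induction e with
  | const a => exact Set.finite_empty
  | avar x => exact Set.finite_singleton _
  | pvar x => exact Set.finite_singleton _
  | pack e ih => exact ih
  | empty => exact Set.finite_empty
  | concat e₁ e₂ ih₁ ih₂ => exact ih₁.union ih₂

end PathExpr

/-- The value of a variable under a valuation. -/
def Valuation.val (ν : Valuation D) : Var → Path D := PathExpr.varVal ν.onAtomic ν.onPath

theorem Valuation.apply_congr {ν ν' : Valuation D} {e : Expr D}
    (h : ∀ v ∈ e.vars, ν.val v = ν'.val v) : ν.apply e = ν'.apply e :=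
  PathExpr.eval_congr h

theorem Predicate.finite_vars (p : Predicate D) : p.vars.Finite :=
  Set.finite_iUnion fun i => (p.args i).finite_vars

theorem Atom.finite_vars : (a : Atom D) → a.vars.Finite
  | pred p => p.finite_vars
  | eqn e₁ e₂ => e₁.finite_vars.union e₂.finite_vars

theorem Rule.finite_vars (r : Rule D) : r.vars.Finite := by
  refine r.head.finite_vars.union ?_
  refine (r.body.finite_toSet.biUnion fun L _ => L.atom.finite_vars).subset ?_
  rintro v ⟨L, hL, hv⟩
  exact Set.mem_biUnion hL hv

/-! ### Finiteness of algebra expressions -/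

theorem finite_substrings {α : Type*} (p : List α) : {s | s <:+: p}.Finite :=
  (List.finite_toSet p.sublists).subset fun _ hs => List.mem_sublists.2 hs.sublist

theorem AlgExpr.finite_eval (I : Instance D) {n : ℕ} (E : AlgExpr D Γ n) : (E.eval I).Finite := by
  induction E with
  | rel R h => exact I.finite R
  | const C => exact C.finite_toSet
  | union E F ihE ihF => exact ihE.union ihF
  | diff E F ihE _ => exact ihE.sdiff
  | prod E F ihE ihF =>
    refine (ihE.image2 Fin.append ihF).subset ?_
    rintro _ ⟨s, hs, t, ht, rfl⟩
    exact Set.mem_image2_of_mem hs ht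
  | select α β E ih => exact ih.subset fun _ h => h.1
  | project α E ih =>
    refine (ih.image fun t j => (α j).apply t).subset ?_
    rintro _ ⟨t, ht, rfl⟩
    exact Set.mem_image_of_mem _ ht
  | unpack i E ih =>
    refine (ih.biUnion (t := fun t => {u | ∃ s : Path D, t i = [Value.pack s] ∧
      u = Function.update t i s}) fun t _ => Set.Subsingleton.finite ?_).subset ?_
    · rintro _ ⟨s, hs, rfl⟩ _ ⟨s', hs', rfl⟩
      simp_all
    · rintro u ⟨t, ht, h⟩
      exact Set.mem_biUnion ht h
  | sub i E ih =>
    refine (ih.biUnion (t := fun t => (fun s => Fin.snoc (α := fun _ => Path D) t s) ''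
      {s | s <:+: t i}) fun t _ => (finite_substrings _).image _).subset ?_
    rintro _ ⟨t, ht, s, hs, rfl⟩
    exact Set.mem_biUnion ht ⟨s, hs, rfl⟩

/-! ### Families of relations definable in the algebra -/

/-- The relations `X I` are the values of an algebra expression. -/
def Definable (Γ : Schema) {n : ℕ} (X : Instance D → Set (Tuple D n)) : Prop :=
  ∃ E : AlgExpr D Γ n, ∀ I, E.eval I = X I

namespace Definable

variable {n m : ℕ} {X Y : Instance D → Set (Tuple D n)}

theorem congr (hX : Definable Γ X) (h : ∀ I, X I = Y I) : Definable Γ Y :=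
  (funext h : X = Y) ▸ hX

theorem rel {R : RelName} (h : R ∈ Γ) : Definable Γ fun I : Instance D => I.rel R :=
  ⟨.rel R h, fun _ => rfl⟩

theorem const (C : Finset (Tuple D n)) : Definable Γ fun _ => {t | t ∈ C} :=
  ⟨.const C, fun _ => rfl⟩

theorem empty : Definable Γ fun _ => (∅ : Set (Tuple D n)) :=
  (const ∅).congr fun _ => by simp

theorem union (hX : Definable Γ X) (hY : Definable Γ Y) : Definable Γ fun I => X I ∪ Y I := by
  obtain ⟨E, hE⟩ := hX
  obtain ⟨F, hF⟩ := hY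
  exact ⟨.union E F, fun I => by simp only [AlgExpr.eval, hE, hF]⟩

theorem diff (hX : Definable Γ X) (hY : Definable Γ Y) : Definable Γ fun I => X I \ Y I := by
  obtain ⟨E, hE⟩ := hX
  obtain ⟨F, hF⟩ := hY
  exact ⟨.diff E F, fun I => by simp only [AlgExpr.eval, hE, hF]⟩

theorem prod {Y : Instance D → Set (Tuple D m)} (hX : Definable Γ X) (hY : Definable Γ Y) :
    Definable Γ fun I => {u | ∃ s ∈ X I, ∃ t ∈ Y I, u = Fin.append s t} := by
  obtain ⟨E, hE⟩ := hX
  obtain ⟨F, hF⟩ := hY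
  exact ⟨.prod E F, fun I => by simp only [AlgExpr.eval, hE, hF]⟩

theorem select (hX : Definable Γ X) (α β : ColExpr D n) :
    Definable Γ fun I => {t | t ∈ X I ∧ α.apply t = β.apply t} := by
  obtain ⟨E, hE⟩ := hX
  exact ⟨.select α β E, fun I => by simp only [AlgExpr.eval, hE]⟩

theorem project (hX : Definable Γ X) (α : Fin m → ColExpr D n) :
    Definable Γ fun I => {u | ∃ t ∈ X I, u = fun j => (α j).apply t} := by
  obtain ⟨E, hE⟩ := hX
  exact ⟨.project α E, fun I => by simp only [AlgExpr.eval, hE]⟩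

theorem unpack (hX : Definable Γ X) (i : Fin n) :
    Definable Γ fun I => {u | ∃ t ∈ X I, ∃ s : Path D, t i = [Value.pack s] ∧
      u = Function.update t i s} := by
  obtain ⟨E, hE⟩ := hX
  exact ⟨.unpack i E, fun I => by simp only [AlgExpr.eval, hE]⟩

theorem sub (hX : Definable Γ X) (i : Fin n) :
    Definable Γ fun I => {u | ∃ t ∈ X I, ∃ s : Path D, s <:+: t i ∧
        u = Fin.snoc (α := fun _ => Path D) t s} := by
  obtain ⟨E, hE⟩ := hX
  exact ⟨.sub i E, fun I => by simp only [AlgExpr.eval, hE]⟩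

theorem selectNe (hX : Definable Γ X) (α β : ColExpr D n) :
    Definable Γ fun I => {t | t ∈ X I ∧ α.apply t ≠ β.apply t} :=
  (hX.diff (hX.select α β)).congr fun I => by ext t; simp +contextual

theorem selectAll (hX : Definable Γ X) (α β : Fin m → ColExpr D n) :
    Definable Γ fun I => {t | t ∈ X I ∧ ∀ j, (α j).apply t = (β j).apply t} := by
  induction m with
  | zero => exact hX.congr fun I => by simp
  | succ m ih =>
    refine ((ih (fun j => α j.succ) fun j => β j.succ).select (α 0) (β 0)).congr fun I => ?_
    ext t
    simp only [Set.mem_ofPred_eq, Fin.forall_fin_succ]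
    tauto

/-- Semijoin: the tuples of `X` whose image under `α` belongs to `Y`. -/
theorem semijoin {Y : Instance D → Set (Tuple D m)} (hX : Definable Γ X) (hY : Definable Γ Y)
    (α : Fin m → ColExpr D n) :
    Definable Γ fun I => {t | t ∈ X I ∧ (fun j => (α j).apply t) ∈ Y I} := by
  let lift : Empty ⊕ Fin n → ColExpr D (n + m) :=
    Sum.elim (fun x => x.elim) fun i => .pvar (Fin.castAdd m i)
  have hlift (e : ColExpr D n) (s : Tuple D n) (t : Tuple D m) :
      ColExpr.apply (Fin.append s t) (e.subst lift) = ColExpr.apply s e := by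
    refine PathExpr.eval_subst fun v _ => ?_
    rcases v with x | i
    · exact x.elim
    · simp [lift, PathExpr.eval, PathExpr.varVal]
  refine (((hX.prod hY).selectAll (fun j => (α j).subst lift)
    (fun j => .pvar (Fin.natAdd n j))).project
      fun i : Fin n => .pvar (Fin.castAdd m i)).congr fun I => ?_
  ext u
  constructor
  · rintro ⟨_, ⟨⟨s, hs, t, ht, rfl⟩, h⟩, rfl⟩
    have hs' : (fun j => ColExpr.apply (Fin.append s t) (.pvar (Fin.castAdd m j))) = s := by
      funext j
      simp [ColExpr.apply, PathExpr.eval]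
    have ht' : (fun j => (α j).apply s) = t := by
      funext j
      rw [← hlift (α j) s t, h j]
      simp [ColExpr.apply, PathExpr.eval]
    rw [hs']
    exact ⟨hs, ht'.symm ▸ ht⟩
  · rintro ⟨hu, hα⟩
    refine ⟨_, ⟨⟨u, hu, _, hα, rfl⟩, fun j => ?_⟩, ?_⟩
    · rw [hlift]
      simp [ColExpr.apply, PathExpr.eval]
    · funext j
      simp [ColExpr.apply, PathExpr.eval]

theorem antijoin {Y : Instance D → Set (Tuple D m)} (hX : Definable Γ X) (hY : Definable Γ Y)
    (α : Fin m → ColExpr D n) :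
    Definable Γ fun I => {t | t ∈ X I ∧ (fun j => (α j).apply t) ∉ Y I} :=
  (hX.diff (hX.semijoin hY α)).congr fun I => by ext t; simp +contextual

/-- Products of unary relations. -/
theorem pi {m : ℕ} {C : Fin m → Instance D → Set (Tuple D 1)} (hC : ∀ i, Definable Γ (C i)) :
    Definable Γ fun I => {t : Tuple D m | ∀ i, (fun _ => t i) ∈ C i I} := by
  induction m with
  | zero =>
    refine (const {fun i => i.elim0}).congr fun I => ?_
    ext t
    simp [Subsingleton.elim t fun i => i.elim0]
  | succ m ih =>
    refine ((ih fun i => hC i.castSucc).prod (hC (Fin.last m))).congr fun I => ?_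
    ext u
    simp only [Set.mem_ofPred_eq, Fin.forall_fin_succ']
    constructor
    · rintro ⟨s, hs, t, ht, rfl⟩
      refine ⟨fun i => ?_, ?_⟩
      · have : Fin.append s t i.castSucc = s i := Fin.append_left s t i
        rw [this]
        exact hs i
      · have : Fin.append s t (Fin.last m) = t 0 := Fin.append_right s t 0
        rw [this]
        convert ht using 2 with j
        rw [Subsingleton.elim j 0]
    · rintro ⟨h, hl⟩
      refine ⟨_, h, _, hl, ?_⟩
      funext i
      refine Fin.lastCases ?_ (fun i => ?_) i
      · exact (Fin.append_right _ (fun _ : Fin 1 => u (Fin.last m)) 0).symm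
      · exact (Fin.append_left (fun i : Fin m => u i.castSucc) _ i).symm

end Definable

theorem eq_nil_or_eq_of_substring_singleton {α : Type*} {u : List α} {a : α} (h : u <:+: [a]) :
    u = [] ∨ u = [a] := by
  simpa using List.sublist_singleton.1 h.sublist

/-- The tuples of a unary relation that consist of a single atomic value. -/
theorem Definable.atomic {X : Instance D → Set (Tuple D 1)} (hX : Definable Γ X) :
    Definable Γ fun I => {t | t ∈ X I ∧ ∃ a, t 0 = [Value.atom a]} := by
  have hpack := (hX.unpack 0).project fun _ : Fin 1 => .pack (.pvar 0)
  have hlong := (((hX.sub 0).selectNe (.pvar 1) .empty).selectNe (.pvar 1) (.pvar 0)).project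
    fun _ : Fin 1 => .pvar 0
  refine (((hX.selectNe (.pvar 0) .empty).diff hpack).diff hlong).congr fun I => ?_
  ext t
  have ht1 : (fun _ => t 0) = t := by
    funext j
    rw [Subsingleton.elim j 0]
  simp only [Set.mem_ofPred_eq, Set.mem_sdiff, ColExpr.apply, PathExpr.eval]
  constructor
  · rintro ⟨⟨⟨ht, hne⟩, hp⟩, hl⟩
    refine ⟨ht, ?_⟩
    match h : t 0 with
    | [] => exact absurd h hne
    | [.atom a] => exact ⟨a, rfl⟩
    | [.pack s] =>
      refine absurd ⟨_, ⟨t, ht, s, h, rfl⟩, ?_⟩ hp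
      rw [← ht1, h]
      simp
    | a :: b :: l =>
      refine absurd ⟨_, ⟨⟨⟨t, ht, [a], ?_, rfl⟩, ?_⟩, ?_⟩, ?_⟩ hl
      · rw [h]
        exact ⟨[], b :: l, rfl⟩
      · simp [Fin.snoc]
      · simp [Fin.snoc, h]
      · rw [← ht1]
        simp [Fin.snoc]
  · rintro ⟨ht, a, ha⟩
    refine ⟨⟨⟨ht, by simp [ha]⟩, ?_⟩, ?_⟩
    · rintro ⟨u, -, hu⟩
      simp [hu] at ha
    · rintro ⟨_, ⟨⟨⟨t', ht', s, hs, rfl⟩, h1⟩, h2⟩, hu⟩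
      have h0 : t 0 = t' 0 := by rw [hu]; simp [Fin.snoc]
      rw [← h0, ha] at hs
      simp only [Fin.snoc] at h1 h2
      rcases eq_nil_or_eq_of_substring_singleton hs with rfl | rfl
      · simp at h1
      · simp [h0 ▸ ha] at h2

/-! ### Definable bounds for the values of variables -/

/-- The values `h ν` of the valuations with `Φ I ν` are bounded by a definable unary relation. -/
def Bounded (Γ : Schema) (Φ : Instance D → Valuation D → Prop) (h : Valuation D → Path D) : Prop :=
  ∃ C : Instance D → Set (Tuple D 1), Definable Γ C ∧ ∀ I ν, Φ I ν → (fun _ => h ν) ∈ C I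

theorem Bounded.apply {Φ : Instance D → Valuation D → Prop} {e : Expr D}
    (h : ∀ v ∈ e.vars, Bounded Γ Φ (·.val v)) : Bounded Γ Φ (·.apply e) := by
  induction e with
  | const a => exact ⟨_, .const {fun _ => [Value.atom a]}, fun I ν _ => by
      simp [Valuation.apply, PathExpr.eval]⟩
  | avar x => exact h _ rfl
  | pvar x => exact h _ rfl
  | pack e ih =>
    obtain ⟨C, hC, hb⟩ := ih h
    exact ⟨_, hC.project fun _ => .pack (.pvar 0), fun I ν hν => ⟨_, hb I ν hν, rfl⟩⟩
  | empty => exact ⟨_, .const {fun _ => []}, fun I ν _ => by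
      simp [Valuation.apply, PathExpr.eval]⟩
  | concat e₁ e₂ ih₁ ih₂ =>
    obtain ⟨C₁, hC₁, hb₁⟩ := ih₁ fun v hv => h v (Or.inl hv)
    obtain ⟨C₂, hC₂, hb₂⟩ := ih₂ fun v hv => h v (Or.inr hv)
    exact ⟨_, (hC₁.prod hC₂).project fun _ => .concat (.pvar 0) (.pvar 1),
      fun I ν hν => ⟨_, ⟨_, hb₁ I ν hν, _, hb₂ I ν hν, rfl⟩, rfl⟩⟩

theorem Bounded.sub {Φ : Instance D → Valuation D → Prop} {h h' : Valuation D → Path D}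
    (hb : Bounded Γ Φ h) (hsub : ∀ ν, h' ν <:+: h ν) : Bounded Γ Φ h' := by
  obtain ⟨C, hC, hb⟩ := hb
  refine ⟨_, (hC.sub 0).project fun _ => .pvar 1,
    fun I ν hν => ⟨_, ⟨_, hb I ν hν, _, hsub ν, rfl⟩, ?_⟩⟩
  simp [ColExpr.apply, PathExpr.eval, Fin.snoc]

theorem Bounded.of_mem_vars {Φ : Instance D → Valuation D → Prop} {e : Expr D}
    (h : Bounded Γ Φ (·.apply e)) {v : Var} (hv : v ∈ e.vars) : Bounded Γ Φ (·.val v) := by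
  induction e with
  | const a => exact hv.elim
  | avar x => cases hv; exact h
  | pvar x => cases hv; exact h
  | pack e ih =>
    refine ih ?_ hv
    obtain ⟨C, hC, hb⟩ := h
    refine ⟨_, hC.unpack 0, fun I ν hν => ⟨_, hb I ν hν, _, rfl, ?_⟩⟩
    funext j
    rw [Subsingleton.elim j 0]
    simp [Valuation.apply]
  | empty => exact hv.elim
  | concat e₁ e₂ ih₁ ih₂ =>
    rcases hv with hv | hv
    · exact ih₁ (h.sub fun ν => ⟨[], e₂.eval ν.onAtomic ν.onPath, rfl⟩) hv
    · exact ih₂ (h.sub fun ν => ⟨e₁.eval ν.onAtomic ν.onPath, [], List.append_nil _⟩) hv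

/-! ### Rules -/

/-- Satisfaction of a literal where positive predicates are evaluated in `X` and negated ones in
`Y`. -/
def Literal.Holds (X Y : (R : RelName) → Set (Tuple D R.arity)) (ν : Valuation D) :
    Literal D → Prop
  | pos (.pred p) => (fun i => ν.apply (p.args i)) ∈ X p.name
  | pos (.eqn e₁ e₂) => ν.apply e₁ = ν.apply e₂
  | neg (.pred p) => (fun i => ν.apply (p.args i)) ∉ Y p.name
  | neg (.eqn e₁ e₂) => ν.apply e₁ ≠ ν.apply e₂

theorem Predicate.apply_congr {ν ν' : Valuation D} {p : Predicate D}
    (h : ∀ v ∈ p.vars, ν.val v = ν'.val v) :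
    (fun i => ν.apply (p.args i)) = fun i => ν'.apply (p.args i) :=
  funext fun i => Valuation.apply_congr fun v hv => h v (Set.mem_iUnion.2 ⟨i, hv⟩)

theorem Literal.holds_congr {X Y : (R : RelName) → Set (Tuple D R.arity)} {ν ν' : Valuation D}
    {L : Literal D} (h : ∀ v ∈ L.atom.vars, ν.val v = ν'.val v) :
    L.Holds X Y ν ↔ L.Holds X Y ν' := by
  rcases L with (p | ⟨e₁, e₂⟩) | (p | ⟨e₁, e₂⟩)
  · simp only [Holds, Predicate.apply_congr (p := p) h]
  · simp only [Holds, Valuation.apply_congr (e := e₁) fun v hv => h v (Or.inl hv),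
      Valuation.apply_congr (e := e₂) fun v hv => h v (Or.inr hv)]
  · simp only [Holds, Predicate.apply_congr (p := p) h]
  · simp only [Holds, Valuation.apply_congr (e := e₁) fun v hv => h v (Or.inl hv),
      Valuation.apply_congr (e := e₂) fun v hv => h v (Or.inr hv)]

theorem Rule.Limited.bounded {X Y : Instance D → (R : RelName) → Set (Tuple D R.arity)} {r : Rule D}
    (hX : ∀ R, r.Uses R → Definable Γ fun I => X I R) {v : Var} (hv : r.Limited v) :
    Bounded Γ (fun I ν => ∀ L ∈ r.body, L.Holds (X I) (Y I) ν) (·.val v) := by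
  induction hv with
  | ofPred p v hp hv =>
    obtain ⟨i, hi⟩ := Set.mem_iUnion.1 hv
    refine Bounded.of_mem_vars ?_ hi
    exact ⟨_, (hX p.name ⟨_, hp, p, rfl, rfl⟩).project fun _ => .pvar i,
      fun I ν hν => ⟨_, hν _ hp, rfl⟩⟩
  | ofLeft e₁ e₂ v he _ hv ih =>
    refine Bounded.of_mem_vars ?_ hv
    obtain ⟨C, hC, hb⟩ := Bounded.apply ih
    refine ⟨C, hC, fun I ν hν => ?_⟩
    have h : ν.apply e₁ = ν.apply e₂ := hν _ he
    simpa only [← h] using hb I ν hν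
  | ofRight e₁ e₂ v he _ hv ih =>
    refine Bounded.of_mem_vars ?_ hv
    obtain ⟨C, hC, hb⟩ := Bounded.apply ih
    refine ⟨C, hC, fun I ν hν => ?_⟩
    have h : ν.apply e₁ = ν.apply e₂ := hν _ he
    simpa only [h] using hb I ν hν

/-- The sets of tuples that satisfy a list of literals, where the valuation of a tuple is given by
`val` and path expressions are translated by `tr`. -/
theorem Definable.filter {X Y : Instance D → (R : RelName) → Set (Tuple D R.arity)} {m : ℕ}
    {Z : Instance D → Set (Tuple D m)} (hZ : Definable Γ Z) (val : Tuple D m → Valuation D)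
    (tr : Expr D → ColExpr D m) (V : Set Var)
    (htr : ∀ I, ∀ t ∈ Z I, ∀ e : Expr D, e.vars ⊆ V → (tr e).apply t = (val t).apply e)
    (body : List (Literal D)) (hV : ∀ L ∈ body, L.atom.vars ⊆ V)
    (hXY : ∀ L ∈ body, ∀ p, L.atom = .pred p →
      Definable Γ (fun I => X I p.name) ∧ Definable Γ fun I => Y I p.name) :
    Definable Γ fun I => {t | t ∈ Z I ∧ ∀ L ∈ body, L.Holds (X I) (Y I) (val t)} := by
  induction body with
  | nil => exact hZ.congr fun I => by simp
  | cons L body ih =>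
    have ih := ih (fun L hL => hV L (List.mem_cons_of_mem _ hL))
      fun L hL => hXY L (List.mem_cons_of_mem _ hL)
    have hL := hV L List.mem_cons_self
    have hLXY := hXY L List.mem_cons_self
    suffices h : Definable Γ fun I => {t | t ∈ {t | t ∈ Z I ∧ ∀ L ∈ body,
        L.Holds (X I) (Y I) (val t)} ∧ L.Holds (X I) (Y I) (val t)} by
      refine h.congr fun I => ?_
      ext t
      simp only [Set.mem_ofPred_eq, List.forall_mem_cons]
      tauto
    have hpred (p : Predicate D) (hp : p.vars ⊆ V) (I) (t) (ht : t ∈ Z I) :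
        (fun j => (tr (p.args j)).apply t) = fun j => (val t).apply (p.args j) :=
      funext fun j => htr I t ht _ ((Set.subset_iUnion (fun i => (p.args i).vars) j).trans hp)
    rcases L with (p | ⟨e₁, e₂⟩) | (p | ⟨e₁, e₂⟩)
    · refine (ih.semijoin (hLXY p rfl).1 fun j => tr (p.args j)).congr fun I => ?_
      ext t
      refine and_congr_right fun ht => ?_
      rw [hpred p hL I t ht.1]
      rfl
    · refine (ih.select (tr e₁) (tr e₂)).congr fun I => ?_
      ext t
      refine and_congr_right fun ht => ?_
      rw [htr I t ht.1 e₁ (Set.subset_union_left.trans hL),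
        htr I t ht.1 e₂ (Set.subset_union_right.trans hL)]
      rfl
    · refine (ih.antijoin (hLXY p rfl).2 fun j => tr (p.args j)).congr fun I => ?_
      ext t
      refine and_congr_right fun ht => ?_
      rw [hpred p hL I t ht.1]
      rfl
    · refine (ih.selectNe (tr e₁) (tr e₂)).congr fun I => ?_
      ext t
      refine and_congr_right fun ht => ?_
      rw [htr I t ht.1 e₁ (Set.subset_union_left.trans hL),
        htr I t ht.1 e₂ (Set.subset_union_right.trans hL)]
      rfl

/-- The atomic value that a path consists of, with default `d`. -/
def atomOf (d : D) : Path D → D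
  | [.atom a] => a
  | _ => d

open Classical in
/-- The valuation of the variables in `V` given by a tuple with columns `c`. -/
noncomputable def tupleValuation (d : D) {m : ℕ} {V : Set Var} (c : V → Fin m) (t : Tuple D m) :
    Valuation D where
  onAtomic i := if h : Sum.inl i ∈ V then atomOf d (t (c ⟨_, h⟩)) else d
  onPath i := if h : Sum.inr i ∈ V then t (c ⟨_, h⟩) else []

open Classical in
/-- Replace the variables in `V` by their columns. -/
noncomputable def toCol {m : ℕ} {V : Set Var} (c : V → Fin m) (e : Expr D) : ColExpr D m :=
  e.subst fun v => if h : v ∈ V then .pvar (c ⟨v, h⟩) else .empty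

theorem tupleValuation_val {d : D} {m : ℕ} {V : Set Var} {c : V → Fin m} {t : Tuple D m}
    (ht : ∀ (i : ℕ) (h : Sum.inl i ∈ V), ∃ a, t (c ⟨_, h⟩) = [Value.atom a]) {v : Var}
    (hv : v ∈ V) : (tupleValuation d c t).val v = t (c ⟨v, hv⟩) := by
  rcases v with i | i
  · obtain ⟨a, ha⟩ := ht i hv
    simp [Valuation.val, PathExpr.varVal, tupleValuation, hv, ha, atomOf]
  · simp [Valuation.val, PathExpr.varVal, tupleValuation, hv]

theorem toCol_apply {d : D} {m : ℕ} {V : Set Var} {c : V → Fin m} {t : Tuple D m}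
    (ht : ∀ (i : ℕ) (h : Sum.inl i ∈ V), ∃ a, t (c ⟨_, h⟩) = [Value.atom a]) {e : Expr D}
    (he : e.vars ⊆ V) : (toCol c e).apply t = (tupleValuation d c t).apply e := by
  refine PathExpr.eval_subst fun v hv => ?_
  rw [dif_pos (he hv)]
  exact (tupleValuation_val ht (he hv)).symm

/-- The facts derived by a safe rule in one step form a definable relation. -/
theorem Rule.Safe.definable [Nonempty D]
    {X Y : Instance D → (R : RelName) → Set (Tuple D R.arity)} {r : Rule D} (hr : r.Safe)
    (hX : ∀ R, r.Uses R → Definable Γ fun I => X I R)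
    (hY : ∀ R, r.Uses R → Definable Γ fun I => Y I R) :
    Definable Γ fun I => {u | ∃ ν : Valuation D, (∀ L ∈ r.body, L.Holds (X I) (Y I) ν) ∧
      u = fun i => ν.apply (r.head.args i)} := by
  obtain ⟨d⟩ := ‹Nonempty D›
  obtain ⟨m, ⟨c⟩⟩ := @Finite.exists_equiv_fin r.vars r.finite_vars
  have hbd (i : Fin m) : ∃ C : Instance D → Set (Tuple D 1), Definable Γ C ∧
      (∀ I ν, (∀ L ∈ r.body, L.Holds (X I) (Y I) ν) → (fun _ => ν.val (c.symm i)) ∈ C I) ∧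
      ∀ k, (c.symm i : Var) = Sum.inl k → ∀ I, ∀ t ∈ C I, ∃ a, t 0 = [Value.atom a] := by
    obtain ⟨C, hC, hb⟩ := (hr _ (c.symm i).2).bounded (Y := Y) hX
    rcases hi : (c.symm i : Var) with k | k
    · refine ⟨_, hC.atomic, fun I ν hν => ⟨hi ▸ hb I ν hν, _, rfl⟩, fun _ _ I t ht => ht.2⟩
    · exact ⟨C, hC, fun I ν hν => hi ▸ hb I ν hν, fun _ h => by cases h⟩
  choose C hC hb hat using hbd
  have hZat (I) (t : Tuple D m) (ht : ∀ i, (fun _ => t i) ∈ C i I) (i : ℕ)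
      (h : Sum.inl i ∈ r.vars) : ∃ a, t (c ⟨_, h⟩) = [Value.atom a] :=
    hat (c ⟨_, h⟩) i (by simp) I _ (ht _)
  have hbody (L) (hL : L ∈ r.body) : L.atom.vars ⊆ r.vars := fun v hv => Or.inr ⟨L, hL, hv⟩
  have hhead (j) : (r.head.args j).vars ⊆ r.vars :=
    fun v hv => Or.inl (Set.mem_iUnion.2 ⟨j, hv⟩)
  refine (((Definable.pi hC).filter (tupleValuation d c) (toCol c) r.vars
    (fun I t ht e he => toCol_apply (hZat I t ht) he) r.body hbody
    fun L hL p hp => ⟨hX _ ⟨L, hL, p, hp, rfl⟩, hY _ ⟨L, hL, p, hp, rfl⟩⟩).project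
      fun j => toCol c (r.head.args j)).congr fun I => ?_
  ext u
  constructor
  · rintro ⟨t, ⟨ht, hL⟩, rfl⟩
    exact ⟨_, hL, funext fun j => toCol_apply (hZat I t ht) (hhead j)⟩
  · rintro ⟨ν, hν, rfl⟩
    have ht (i) : (fun _ => ν.val (c.symm i)) ∈ C i I := hb i I ν hν
    have hval (v) (hv : v ∈ r.vars) :
        (tupleValuation d c fun i => ν.val (c.symm i)).val v = ν.val v := by
      rw [tupleValuation_val (hZat I _ ht) hv]
      simp
    refine ⟨fun i => ν.val (c.symm i), ⟨ht, fun L hL => ?_⟩, funext fun j => ?_⟩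
    · exact (Literal.holds_congr fun v hv => hval v (hbody L hL hv)).2 (hν L hL)
    · rw [toCol_apply (d := d) (hZat I _ ht) (hhead j)]
      exact (Valuation.apply_congr fun v hv => hval v (hhead j hv)).symm

/-! ### Strata -/

/-- The facts derived from `I` by the rules of a stratum, with negation evaluated in `I`. -/
inductive Derived (S : Stratum D) (I : Instance D) : (R : RelName) → Tuple D R.arity → Prop
  | base {R : RelName} {t : Tuple D R.arity} : t ∈ I.rel R → Derived S I R t
  | step (r : Rule D) (ν : Valuation D) : r ∈ S →
      (∀ p, Literal.pos (.pred p) ∈ r.body → Derived S I p.name fun i => ν.apply (p.args i)) →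
      (∀ L ∈ r.body, (∀ p, L ≠ .pos (.pred p)) → L.Sat I ν) →
      Derived S I r.head.name fun i => ν.apply (r.head.args i)

theorem Literal.holds_of_pos_of_sat {X : (R : RelName) → Set (Tuple D R.arity)} {I : Instance D}
    {ν : Valuation D} {L : Literal D}
    (hpos : ∀ p, L = .pos (.pred p) → (fun i => ν.apply (p.args i)) ∈ X p.name)
    (hsat : (∀ p, L ≠ .pos (.pred p)) → L.Sat I ν) : L.Holds X I.rel ν := by
  rcases L with (p | ⟨e₁, e₂⟩) | (p | ⟨e₁, e₂⟩)
  · exact hpos p rfl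
  all_goals exact hsat fun p => by simp

theorem Literal.Holds.sat {X : (R : RelName) → Set (Tuple D R.arity)} {I : Instance D}
    {ν : Valuation D} {L : Literal D} (h : L.Holds X I.rel ν) (hL : ∀ p, L ≠ .pos (.pred p)) :
    L.Sat I ν := by
  rcases L with (p | ⟨e₁, e₂⟩) | (p | ⟨e₁, e₂⟩)
  · exact absurd rfl (hL p)
  all_goals exact h

theorem Literal.sat_iff_of_agree {I J : Instance D} {ν : Valuation D} {L : Literal D}
    (hL : ∀ p, L ≠ .pos (.pred p)) (h : ∀ p, L = .neg (.pred p) → I.rel p.name = J.rel p.name) :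
    L.Sat I ν ↔ L.Sat J ν := by
  rcases L with (p | ⟨e₁, e₂⟩) | (p | ⟨e₁, e₂⟩)
  · exact absurd rfl (hL p)
  · rfl
  · simp only [Sat, Atom.Sat, Predicate.Sat, h p rfl]
  · rfl

theorem derived_iff {S : Stratum D} {I : Instance D} {R : RelName} {t : Tuple D R.arity} :
    Derived S I R t ↔ t ∈ I.rel R ∨ ∃ r ∈ S, ∃ h : r.head.name = R, ∃ ν : Valuation D,
      (∀ L ∈ r.body, L.Holds (fun R => {t | Derived S I R t}) I.rel ν) ∧
        t = h ▸ fun i => ν.apply (r.head.args i) := by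
  constructor
  · rintro (ht | ⟨r, ν, hr, hp, hL⟩)
    · exact Or.inl ht
    · exact Or.inr ⟨r, hr, rfl, ν, fun L hL' => Literal.holds_of_pos_of_sat
        (fun p h => hp p (h ▸ hL')) (hL L hL'), rfl⟩
  · rintro (ht | ⟨r, hr, rfl, ν, hL, rfl⟩)
    · exact .base ht
    · exact .step r ν hr (fun p hp => hL _ hp) fun L hL' h => (hL L hL').sat h

theorem derived_iff_of_notMem_heads {S : Stratum D} {I : Instance D} {R : RelName}
    {t : Tuple D R.arity} (hR : R ∉ S.heads) : Derived S I R t ↔ t ∈ I.rel R := by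
  rw [derived_iff, or_iff_left]
  rintro ⟨r, hr, h, -⟩
  exact hR ⟨r, hr, h⟩

/-- If the derived facts form an instance, then it is the result of applying the stratum. -/
theorem Stratum.isResult_of_derived {S : Stratum D} {I J : Instance D}
    (hneg : ∀ r ∈ S, ∀ p : Predicate D, Literal.neg (.pred p) ∈ r.body → p.name ∉ S.heads)
    (hJ : ∀ R, J.rel R = {t | Derived S I R t}) : S.IsResult I J := by
  have agree {K : Instance D} (hK : ∀ R, R ∉ S.heads → K.rel R = I.rel R) {r : Rule D}
      (hr : r ∈ S) {L : Literal D} (hL : L ∈ r.body) (hLp : ∀ p, L ≠ .pos (.pred p))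
      (ν : Valuation D) : L.Sat K ν ↔ L.Sat I ν :=
    Literal.sat_iff_of_agree hLp fun p hp => hK _ (hneg r hr p (hp ▸ hL))
  have hJI (R) (hR : R ∉ S.heads) : J.rel R = I.rel R := by
    ext t
    rw [hJ]
    exact derived_iff_of_notMem_heads hR
  refine ⟨⟨fun R t ht => ?_, hJI, fun r hr ν hν => ?_⟩, fun K hK R t ht => ?_⟩
  · rw [hJ]
    exact Derived.base ht
  · rw [Predicate.Sat, hJ]
    refine Derived.step r ν hr (fun p hp => ?_) fun L hL hLp => (agree hJI hr hL hLp ν).1 (hν L hL)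
    have := hν _ hp
    simp only [Literal.Sat, Atom.Sat, Predicate.Sat, hJ] at this
    exact this
  · rw [hJ] at ht
    obtain ⟨hIK, hKI, hKS⟩ := hK
    induction ht with
    | base ht => exact hIK _ ht
    | step r ν hr _ hL ih =>
      refine hKS r hr ν fun L hL' => ?_
      by_cases h : ∃ p, L = .pos (.pred p)
      · obtain ⟨p, rfl⟩ := h
        exact ih p hL'
      · push Not at h
        exact (agree hKI hr hL' h ν).2 (hL L hL' h)

/-- The relations of the instances `G I` are definable. -/
def DefinableInstance (Γ : Schema) (G : Instance D → Instance D) : Prop :=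
  ∀ R, Definable Γ fun I => (G I).rel R

theorem DefinableInstance.derived [Nonempty D] {G : Instance D → Instance D}
    (hG : DefinableInstance Γ G) {S : Stratum D} (hsafe : ∀ r ∈ S, r.Safe)
    {dep : RelName → RelName → Prop} (hdep : WellFounded dep)
    (huse : ∀ r ∈ S, ∀ R ∈ S.heads, r.Uses R → dep R r.head.name) (R : RelName) :
    Definable Γ fun I => {t | Derived S (G I) R t} := by
  induction R using hdep.induction with
  | _ R ih =>
    have hused (r) (hr : r ∈ S) (hR : r.head.name = R) (R') (hu : r.Uses R') :
        Definable Γ fun I => {t | Derived S (G I) R' t} := by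
      by_cases hh : R' ∈ S.heads
      · exact ih R' (hR ▸ huse r hr R' hh hu)
      · exact (hG R').congr fun I => Set.ext fun t => (derived_iff_of_notMem_heads hh).symm
    suffices h : ∀ S' : Stratum D, S' ⊆ S → Definable Γ fun I => {t | t ∈ (G I).rel R ∨ ∃ r ∈ S',
        ∃ h : r.head.name = R, ∃ ν : Valuation D,
        (∀ L ∈ r.body, L.Holds (fun R => {t | Derived S (G I) R t}) (G I).rel ν) ∧
          t = h ▸ fun i => ν.apply (r.head.args i)} from
      (h S (List.Subset.refl _)).congr fun I => Set.ext fun t => derived_iff.symm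
    intro S' hS'
    induction S' with
    | nil => exact (hG R).congr fun I => by simp
    | cons r S' ihS =>
      obtain ⟨hr, hS'⟩ := List.cons_subset.1 hS'
      by_cases hR : r.head.name = R
      · subst hR
        refine ((ihS hS').union ((hsafe r hr).definable (hused r hr rfl)
          fun R _ => hG R)).congr fun I => ?_
        ext t
        simp only [Set.mem_union, Set.mem_ofPred_eq, List.mem_cons, exists_eq_or_imp,
          exists_true_left]
        exact or_assoc.trans (or_congr_right or_comm)
      · refine (ihS hS').congr fun I => ?_
        simp [hR]

theorem DefinableInstance.stratum [Nonempty D] {G : Instance D → Instance D}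
    (hG : DefinableInstance Γ G) {S : Stratum D} (hsafe : ∀ r ∈ S, r.Safe)
    {dep : RelName → RelName → Prop} (hdep : WellFounded dep)
    (huse : ∀ r ∈ S, ∀ R ∈ S.heads, r.Uses R → dep R r.head.name)
    (hneg : ∀ r ∈ S, ∀ p : Predicate D, Literal.neg (.pred p) ∈ r.body → p.name ∉ S.heads) :
    ∃ G' : Instance D → Instance D, DefinableInstance Γ G' ∧ ∀ I, S.IsResult (G I) (G' I) := by
  have hd := hG.derived hsafe hdep huse
  refine ⟨fun I => ⟨fun R => {t | Derived S (G I) R t}, fun R => ?_⟩, hd,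
    fun I => Stratum.isResult_of_derived hneg fun R => rfl⟩
  obtain ⟨E, hE⟩ := hd R
  exact (E.finite_eval I).subset (hE I).symm.le

theorem DefinableInstance.strata [Nonempty D] {dep : RelName → RelName → Prop}
    (hdep : WellFounded dep) (Q : List (Stratum D)) {G : Instance D → Instance D}
    (hG : DefinableInstance Γ G) (hsafe : ∀ S ∈ Q, ∀ r ∈ S, r.Safe)
    (huse : ∀ S ∈ Q, ∀ r ∈ S, ∀ R ∈ S.heads, r.Uses R → dep R r.head.name)
    (hQ : Stratified Q) :
    ∃ G' : Instance D → Instance D, DefinableInstance Γ G' ∧ ∀ I, StrataResult Q (G I) (G' I) := by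
  induction Q generalizing G with
  | nil => exact ⟨G, hG, fun I => rfl⟩
  | cons S Q ih =>
    obtain ⟨hneg, hQ⟩ := hQ
    obtain ⟨G₁, hG₁, h₁⟩ := hG.stratum (hsafe S List.mem_cons_self) hdep
      (huse S List.mem_cons_self) fun r hr p hp => hneg r hr p hp S List.mem_cons_self
    obtain ⟨G₂, hG₂, h₂⟩ := ih hG₁ (fun S hS => hsafe S (List.mem_cons_of_mem _ hS))
      (fun S hS => huse S (List.mem_cons_of_mem _ hS)) hQ
    exact ⟨G₂, hG₂, fun I => ⟨G₁ I, h₁ I, h₂ I⟩⟩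

theorem Program.finite_idb (P : Program D) : P.idb.Finite := by
  refine ((P.strata.flatten.finite_toSet).image fun r => r.head.name).subset ?_
  rintro R ⟨r, ⟨S, hS, hr⟩, rfl⟩
  exact ⟨r, List.mem_flatten.2 ⟨S, hS, hr⟩, rfl⟩

theorem Program.Nonrecursive.wellFounded {P : Program D} (hP : P.Nonrecursive) :
    WellFounded (Function.swap P.DependsOn) := by
  let lt : RelName → RelName → Prop := Function.swap (Relation.TransGen P.DependsOn)
  have : IsStrictOrder RelName lt :=
    { irrefl := hP, trans := fun _ _ _ h h' => Relation.TransGen.trans h' h }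
  exact Subrelation.wf (fun h => ⟨.single h, h.2.1, h.1⟩)
    (Set.wellFoundedOn_iff.1 (P.finite_idb.wellFoundedOn (r := lt)))

open Classical in
/-- The restriction of an instance to a schema. -/
noncomputable def Instance.restrict (I : Instance D) (Γ : Schema) : Instance D where
  rel R := if R ∈ Γ then I.rel R else ∅
  finite R := by
    split
    · exact I.finite R
    · exact Set.finite_empty

theorem Instance.Over.restrict_eq {I : Instance D} (hI : I.Over Γ) : I.restrict Γ = I := by
  ext1
  funext R
  by_cases h : R ∈ Γ
  · simp [restrict, h]
  · simp [restrict, h, hI R h]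

theorem definableInstance_restrict : DefinableInstance (D := D) Γ fun I => I.restrict Γ := by
  intro R
  by_cases h : R ∈ Γ
  · exact (Definable.rel h).congr fun I => by simp [Instance.restrict, h]
  · exact Definable.empty.congr fun I => by simp [Instance.restrict, h]

/-- Nonrecursive programs are expressible in the algebra. -/
theorem Program.Nonrecursive.exists_algExpr [Nonempty D] {P : Program D} (hP : P.Nonrecursive)
    (T : RelName) : ∃ E : AlgExpr D Γ T.arity, ∀ I : Instance D, I.Over Γ →
      ∃ J : Instance D, P.IsResult I J ∧ J.rel T = E.eval I := by
  obtain ⟨G, hG, h⟩ := (definableInstance_restrict (D := D) (Γ := Γ)).strata hP.wellFounded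
    P.strata P.safe (fun S hS r hr R ⟨r', hr', hR⟩ hu =>
      ⟨⟨r, ⟨S, hS, hr⟩, rfl⟩, ⟨r', ⟨S, hS, hr'⟩, hR⟩, r, ⟨S, hS, hr⟩, rfl, hu⟩) P.stratified
  obtain ⟨E, hE⟩ := hG T
  refine ⟨E, fun I hI => ⟨G I, ?_, (hE I).symm⟩⟩
  have := h I
  rwa [hI.restrict_eq] at this

/-! ### Sequences of strata that define fresh relation names -/

theorem StrataResult.append {Q₁ Q₂ : List (Stratum D)} {I J K : Instance D}
    (h₁ : StrataResult Q₁ I J) (h₂ : StrataResult Q₂ J K) : StrataResult (Q₁ ++ Q₂) I K := by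
  induction Q₁ generalizing I with
  | nil => cases h₁; exact h₂
  | cons S Q₁ ih =>
    obtain ⟨I', hI', h⟩ := h₁
    exact ⟨I', hI', ih h⟩

theorem Stratified.append {Q₁ Q₂ : List (Stratum D)} (h₁ : Stratified Q₁) (h₂ : Stratified Q₂)
    (h : ∀ S ∈ Q₁, ∀ r ∈ S, ∀ p : Predicate D, Literal.neg (.pred p) ∈ r.body →
      ∀ S' ∈ Q₂, p.name ∉ Stratum.heads S') : Stratified (Q₁ ++ Q₂) := by
  induction Q₁ with
  | nil => exact h₂
  | cons S Q₁ ih =>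
    refine ⟨fun r hr p hp S' hS' => ?_, ih h₁.2 fun S hS => h S (List.mem_cons_of_mem _ hS)⟩
    rcases List.mem_append.1 (show S' ∈ (S :: Q₁) ++ Q₂ from hS') with hS' | hS'
    · exact h₁.1 r hr p hp S' hS'
    · exact h S List.mem_cons_self r hr p hp S' hS'

/-- The relation names defined by a sequence of strata. -/
def headNames (Q : List (Stratum D)) : Set RelName := {R | ∃ S ∈ Q, R ∈ S.heads}

theorem headNames_append (Q₁ Q₂ : List (Stratum D)) :
    headNames (Q₁ ++ Q₂) = headNames Q₁ ∪ headNames Q₂ := by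
  ext R
  simp [headNames, or_and_right, exists_or]

/-- A sequence of strata that defines relation names with identifiers in `[N, k)`, each by means of
names from `A` or defined names, in all cases with smaller identifiers. -/
structure Layer (A : Set RelName) (N k : ℕ) (Q : List (Stratum D)) : Prop where
  safe : ∀ S ∈ Q, ∀ r ∈ S, r.Safe
  bounds : ∀ S ∈ Q, ∀ r ∈ S, N ≤ r.head.name.id ∧ r.head.name.id < k
  lt : ∀ S ∈ Q, ∀ r ∈ S, ∀ R, r.Uses R → R.id < r.head.name.id
  closed : ∀ S ∈ Q, ∀ r ∈ S, ∀ R, r.Uses R → R ∈ A ∨ R ∈ headNames Q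
  stratified : Stratified Q

theorem Layer.nil {A : Set RelName} {N : ℕ} : Layer A N N ([] : List (Stratum D)) where
  safe := by simp
  bounds := by simp
  lt := by simp
  closed := by simp
  stratified := trivial

theorem Layer.append {A : Set RelName} {N k l : ℕ} {Q₁ Q₂ : List (Stratum D)} (hNk : N ≤ k)
    (hkl : k ≤ l) (h₁ : Layer A N k Q₁) (h₂ : Layer (A ∪ headNames Q₁) k l Q₂) :
    Layer A N l (Q₁ ++ Q₂) where
  safe S hS := (List.mem_append.1 hS).elim (h₁.safe S) (h₂.safe S)
  bounds S hS r hr := by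
    rcases List.mem_append.1 hS with hS | hS
    · have := h₁.bounds S hS r hr
      omega
    · have := h₂.bounds S hS r hr
      omega
  lt S hS := (List.mem_append.1 hS).elim (h₁.lt S) (h₂.lt S)
  closed S hS r hr R hR := by
    rw [headNames_append]
    rcases List.mem_append.1 hS with hS | hS
    · exact (h₁.closed S hS r hr R hR).imp_right Or.inl
    · rcases h₂.closed S hS r hr R hR with (h | h) | h
      · exact Or.inl h
      · exact Or.inr (Or.inl h)
      · exact Or.inr (Or.inr h)
  stratified := by
    refine h₁.stratified.append h₂.stratified fun S hS r hr p hp S' hS' ⟨r', hr', h⟩ => ?_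
    have := h₁.bounds S hS r hr
    have := h₁.lt S hS r hr p.name ⟨_, hp, p, rfl, rfl⟩
    have := h₂.bounds S' hS' r' hr'
    rw [h] at this
    omega

theorem Layer.mono {A B : Set RelName} {N k : ℕ} {Q : List (Stratum D)} (h : Layer A N k Q)
    (hAB : A ⊆ B) : Layer B N k Q :=
  { h with closed := fun S hS r hr R hR => (h.closed S hS r hr R hR).imp_left (@hAB R) }

/-- On instances without facts on identifiers from `N` on, the strata `Q` have a result, which
differs from the given instance only for identifiers in `[N, k)` and satisfies `Ψ`. -/
def Runs (N k : ℕ) (Q : List (Stratum D)) (Ψ : Instance D → Instance D → Prop) : Prop :=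
  ∀ I : Instance D, (∀ R, N ≤ R.id → I.rel R = ∅) → ∃ J, StrataResult Q I J ∧
    (∀ R, R.id < N ∨ k ≤ R.id → J.rel R = I.rel R) ∧ Ψ I J

theorem AlgExpr.eval_congr {I J : Instance D} (h : ∀ R ∈ Γ, I.rel R = J.rel R) {n : ℕ}
    (E : AlgExpr D Γ n) : E.eval I = E.eval J := by
  induction E with
  | rel R hR => exact h R hR
  | const C => rfl
  | _ => simp_all only [eval]

/-- The expression `E` is computed, in the relation name with identifier `k`, by a sequence of
strata that defines relation names with identifiers in `[N, k]`. -/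
def Compiles {n : ℕ} (E : AlgExpr D Γ n) (N k : ℕ) (Q : List (Stratum D)) : Prop :=
  N ≤ k ∧ Layer (Γ : Set RelName) N (k + 1) Q ∧ (⟨k, n⟩ : RelName) ∈ headNames Q ∧
    Runs N (k + 1) Q fun I J => J.rel ⟨k, n⟩ = E.eval I

theorem Compiles.append {m n : ℕ} {E : AlgExpr D Γ m} {F : AlgExpr D Γ n} {N k l : ℕ}
    {Q₁ Q₂ : List (Stratum D)} (hΓ : ∀ R ∈ Γ, R.id < N) (h₁ : Compiles E N k Q₁)
    (h₂ : Compiles F (k + 1) l Q₂) : Layer (Γ : Set RelName) N (l + 1) (Q₁ ++ Q₂) ∧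
      Runs N (l + 1) (Q₁ ++ Q₂) fun I J =>
        J.rel ⟨k, m⟩ = E.eval I ∧ J.rel ⟨l, n⟩ = F.eval I := by
  obtain ⟨hNk, hL₁, hT₁, hR₁⟩ := h₁
  obtain ⟨hkl, hL₂, hT₂, hR₂⟩ := h₂
  refine ⟨hL₁.append (by omega) (by omega) (hL₂.mono Set.subset_union_left), fun I hI => ?_⟩
  obtain ⟨J, hJ, hfJ, hE⟩ := hR₁ I hI
  obtain ⟨K, hK, hfK, hF⟩ := hR₂ J fun R hR => by
    rw [hfJ R (Or.inr hR), hI R (by omega)]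
  refine ⟨K, hJ.append hK, fun R hR => ?_, ?_, ?_⟩
  · rw [hfK R (by omega), hfJ R (by omega)]
  · rw [hfK _ (by simp), hE]
  · rw [hF]
    exact AlgExpr.eval_congr (fun R hR => hfJ R (Or.inl (hΓ R hR))) F

/-! ### Strata that define one relation name -/

theorem Literal.sat_congr {I J : Instance D} {ν : Valuation D} {L : Literal D}
    (h : ∀ p, L.atom = .pred p → I.rel p.name = J.rel p.name) : L.Sat I ν ↔ L.Sat J ν := by
  rcases L with (p | ⟨e₁, e₂⟩) | (p | ⟨e₁, e₂⟩)
  · simp only [Sat, Atom.Sat, Predicate.Sat, h p rfl]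
  · rfl
  · simp only [Sat, Atom.Sat, Predicate.Sat, h p rfl]
  · rfl

/-- The arguments of the head and the body of a rule for an `n`-ary relation name. -/
abbrev Clause (D : Type u) (n : ℕ) : Type u := (Fin n → Expr D) × List (Literal D)

/-- The rule with the given clause for the relation name `⟨k, n⟩`. -/
def Clause.rule {n : ℕ} (k : ℕ) (q : Clause D n) : Rule D := ⟨⟨⟨k, n⟩, q.1⟩, q.2⟩

/-- The tuples derived by clauses in one step. -/
def derivedBy {n : ℕ} (B : List (Clause D n)) (J : Instance D) : Set (Tuple D n) :=
  {u | ∃ q ∈ B, ∃ ν : Valuation D, (∀ L ∈ q.2, L.Sat J ν) ∧ u = fun i => ν.apply (q.1 i)}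

open Classical in
/-- Replace the relation with name `T`. -/
noncomputable def Instance.set (I : Instance D) (T : RelName) (X : Set (Tuple D T.arity))
    (hX : X.Finite) : Instance D where
  rel := Function.update I.rel T X
  finite R := by
    by_cases h : R = T
    · subst h
      simpa using hX
    · simpa [h] using I.finite R

theorem Instance.set_same (I : Instance D) {T : RelName} {X : Set (Tuple D T.arity)}
    (hX : X.Finite) : (I.set T X hX).rel T = X := by
  simp [Instance.set]

theorem Instance.set_of_ne (I : Instance D) {T R : RelName} (h : R ≠ T)
    {X : Set (Tuple D T.arity)} (hX : X.Finite) : (I.set T X hX).rel R = I.rel R := by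
  simp [Instance.set, h]

theorem mem_heads_rules {n k : ℕ} {B : List (Clause D n)} (hB : B ≠ []) {R : RelName} :
    R ∈ Stratum.heads (B.map (Clause.rule k)) ↔ R = ⟨k, n⟩ := by
  constructor
  · rintro ⟨r, hr, rfl⟩
    obtain ⟨q, -, rfl⟩ := List.mem_map.1 hr
    rfl
  · rintro rfl
    obtain ⟨q, hq⟩ := List.exists_mem_of_ne_nil B hB
    exact ⟨_, List.mem_map_of_mem hq, rfl⟩

theorem isResult_rules {n k : ℕ} {B : List (Clause D n)} (hB : B ≠ []) {J : Instance D}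
    (huse : ∀ q ∈ B, ∀ R, (Clause.rule k q).Uses R → R ≠ ⟨k, n⟩) (hJ : J.rel ⟨k, n⟩ = ∅)
    (hfin : (derivedBy B J).Finite) :
    Stratum.IsResult (B.map (Clause.rule k)) J (J.set ⟨k, n⟩ (derivedBy B J) hfin) := by
  have hsat {K : Instance D} (hK : ∀ R, R ≠ ⟨k, n⟩ → K.rel R = J.rel R) {q : Clause D n}
      (hq : q ∈ B) {L : Literal D} (hL : L ∈ q.2) (ν : Valuation D) : L.Sat K ν ↔ L.Sat J ν :=
    Literal.sat_congr fun p hp => hK _ (huse q hq _ ⟨L, hL, p, hp, rfl⟩)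
  have hset (R) (hR : R ≠ ⟨k, n⟩) := J.set_of_ne hR hfin
  refine ⟨⟨fun R => ?_, fun R hR => ?_, fun r hr ν hν => ?_⟩, fun K hK R => ?_⟩
  · by_cases hR : R = ⟨k, n⟩
    · subst hR
      simp [hJ]
    · rw [hset R hR]
  · exact hset R fun h => hR ((mem_heads_rules hB).2 h)
  · obtain ⟨q, hq, rfl⟩ := List.mem_map.1 hr
    have : (fun i => ν.apply (q.1 i)) ∈ derivedBy B J :=
      ⟨q, hq, ν, fun L hL => (hsat hset hq hL ν).1 (hν L hL), rfl⟩
    rwa [← J.set_same (T := ⟨k, n⟩) hfin] at this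
  · obtain ⟨hJK, hKJ, hKS⟩ := hK
    by_cases hR : R = ⟨k, n⟩
    · subst hR
      rw [J.set_same hfin]
      rintro _ ⟨q, hq, ν, hν, rfl⟩
      refine hKS _ (List.mem_map_of_mem hq) ν fun L hL => ?_
      exact (hsat (fun R hR => hKJ R fun h => hR ((mem_heads_rules hB).1 h)) hq hL ν).2 (hν L hL)
    · rw [hset R hR]
      exact hJK R

/-- Add a stratum for the relation name `⟨k, n⟩`. -/
theorem Runs.compiles {n N k : ℕ} {Q : List (Stratum D)} {Ψ : Instance D → Instance D → Prop}
    (hQ : Runs N k Q Ψ) (hL : Layer (Γ : Set RelName) N k Q) (hNk : N ≤ k) {E : AlgExpr D Γ n}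
    (hΓ : ∀ R ∈ Γ, R.id < N) {B : List (Clause D n)} (hB : B ≠ [])
    (hsafe : ∀ q ∈ B, (Clause.rule k q).Safe)
    (huse : ∀ q ∈ B, ∀ L ∈ q.2, ∀ p, L.atom = .pred p → p.name ∈ (Γ : Set RelName) ∪ headNames Q)
    (heval : ∀ I J, (∀ R ∈ Γ, J.rel R = I.rel R) → Ψ I J → derivedBy B J = E.eval I) :
    ∃ Q', Compiles E N k Q' := by
  have hlt (R) (hR : R ∈ (Γ : Set RelName) ∪ headNames Q) : R.id < k := by
    rcases hR with hR | ⟨S, hS, r, hr, rfl⟩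
    · exact (hΓ R hR).trans_le hNk
    · exact (hL.bounds S hS r hr).2
  have huse' (q) (hq : q ∈ B) (R) (h : (Clause.rule k q).Uses R) :
      R ∈ (Γ : Set RelName) ∪ headNames Q := by
    obtain ⟨L, hL, p, hp, rfl⟩ := h
    exact huse q hq L hL p hp
  refine ⟨Q ++ [B.map (Clause.rule k)], hNk, hL.append hNk (Nat.le_succ k) ?_, ?_, fun I hI => ?_⟩
  · constructor
    · simpa only [List.mem_singleton, forall_eq, List.forall_mem_map] using hsafe
    · simp only [List.mem_singleton, forall_eq, List.forall_mem_map]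
      exact fun q _ => ⟨le_rfl, Nat.lt_succ_self k⟩
    · simp only [List.mem_singleton, forall_eq, List.forall_mem_map]
      exact fun q hq R hR => hlt R (huse' q hq R hR)
    · simp only [List.mem_singleton, forall_eq, List.forall_mem_map]
      exact fun q hq R hR => Or.inl (huse' q hq R hR)
    · refine ⟨fun r hr p hp S hS => ?_, trivial⟩
      rw [List.mem_singleton.1 hS, mem_heads_rules hB]
      obtain ⟨q, hq, rfl⟩ := List.mem_map.1 hr
      intro h
      have := hlt _ (huse q hq _ hp p rfl)
      rw [h] at this
      exact lt_irrefl _ this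
  · rw [headNames_append]
    exact Or.inr ⟨_, List.mem_singleton_self _, (mem_heads_rules hB).2 rfl⟩
  · obtain ⟨J, hJ, hfJ, hΨ⟩ := hQ I hI
    have hE := heval I J (fun R hR => hfJ R (Or.inl (hΓ R hR))) hΨ
    have hfin : (derivedBy B J).Finite := hE ▸ E.finite_eval I
    refine ⟨_, hJ.append ⟨_, isResult_rules hB (fun q hq R hR h => ?_) ?_ hfin, rfl⟩,
      fun R hR => ?_, ?_⟩
    · have := hlt R (huse' q hq R hR)
      rw [h] at this
      exact lt_irrefl _ this
    · rw [hfJ _ (Or.inr le_rfl), hI _ hNk]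
    · rw [J.set_of_ne _ hfin, hfJ R (by omega)]
      rintro rfl
      simp at hR
      omega
    · exact (J.set_same hfin).trans hE

/-! ### Translation of the operators -/

/-- The predicate `R(x₀, …, xₙ₋₁)`. -/
def cols (R : RelName) : Predicate D := ⟨R, fun i => .pvar i⟩

theorem mem_vars_cols {R : RelName} {v : Var} :
    v ∈ (cols R : Predicate D).vars ↔ ∃ i < R.arity, v = Sum.inr i := by
  simp only [Predicate.vars, cols, PathExpr.vars, Set.mem_iUnion, Set.mem_singleton_iff]
  exact ⟨fun ⟨i, h⟩ => ⟨i, i.2, h⟩, fun ⟨i, hi, h⟩ => ⟨⟨i, hi⟩, h⟩⟩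

/-- A column expression as a path expression of Sequence Datalog. -/
def toExpr {n : ℕ} (α : ColExpr D n) : Expr D :=
  α.subst (Sum.elim (fun x : Empty => x.elim) fun i : Fin n => .pvar i)

theorem apply_toExpr {n : ℕ} (ν : Valuation D) (α : ColExpr D n) :
    ν.apply (toExpr α) = α.apply fun i => ν.onPath i := by
  refine PathExpr.eval_subst fun v _ => ?_
  rcases v with x | i
  · exact x.elim
  · rfl

theorem lt_of_mem_vars_toExpr {n : ℕ} {α : ColExpr D n} {v : Var} (hv : v ∈ (toExpr α).vars) :
    ∃ i < n, v = Sum.inr i := by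
  induction α with
  | const a => exact hv.elim
  | avar x => exact x.elim
  | pvar i => exact ⟨i, i.2, hv⟩
  | pack e ih => exact ih hv
  | empty => exact hv.elim
  | concat e₁ e₂ ih₁ ih₂ => exact hv.elim ih₁ ih₂

/-- A valuation that maps the first path variables to the components of a tuple. -/
noncomputable def ofTuple [Nonempty D] {n : ℕ} (t : Tuple D n) : Valuation D where
  onAtomic _ := Classical.arbitrary D
  onPath i := if h : i < n then t ⟨i, h⟩ else []

theorem ofTuple_onPath [Nonempty D] {n : ℕ} (t : Tuple D n) (i : Fin n) :
    (ofTuple t).onPath i = t i := by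
  simp [ofTuple]

theorem Clause.safe_of_limited {n k : ℕ} {q : Clause D n}
    (hhead : ∀ i, ∀ v ∈ (q.1 i).vars, (q.rule k).Limited v)
    (hbody : ∀ L ∈ q.2, ∀ v ∈ L.atom.vars, (q.rule k).Limited v) : (q.rule k).Safe := by
  rintro v (hv | ⟨L, hL, hv⟩)
  · obtain ⟨i, hi⟩ := Set.mem_iUnion.1 hv
    exact hhead i v hi
  · exact hbody L hL v hv

/-- A clause is safe if its variables are columns of a positive body predicate. -/
theorem Clause.safe_of_cols {n k : ℕ} {q : Clause D n} {R : RelName}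
    (hR : .pos (.pred (cols R)) ∈ q.2)
    (hhead : ∀ i, ∀ v ∈ (q.1 i).vars, ∃ j < R.arity, v = Sum.inr j)
    (hbody : ∀ L ∈ q.2, ∀ v ∈ L.atom.vars, ∃ j < R.arity, v = Sum.inr j) : (q.rule k).Safe := by
  have (v : Var) (hv : ∃ j < R.arity, v = Sum.inr j) : (q.rule k).Limited v :=
    .ofPred (cols R) v hR (mem_vars_cols.2 hv)
  exact safe_of_limited (fun i v hv => this v (hhead i v hv))
    fun L hL v hv => this v (hbody L hL v hv)

mutual

theorem Value.exists_expr : (x : Value D) →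
    ∃ e : Expr D, e.vars = ∅ ∧ ∀ ν : Valuation D, ν.apply e = [x]
  | .atom a => ⟨.const a, rfl, fun _ => rfl⟩
  | .pack p => by
    obtain ⟨e, he, h⟩ := Path.exists_expr p
    refine ⟨.pack e, he, fun ν => ?_⟩
    rw [← h ν]
    rfl

theorem Path.exists_expr : (p : List (Value D)) →
    ∃ e : Expr D, e.vars = ∅ ∧ ∀ ν : Valuation D, ν.apply e = p
  | [] => ⟨.empty, rfl, fun _ => rfl⟩
  | x :: p => by
    obtain ⟨e₁, he₁, h₁⟩ := Value.exists_expr x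
    obtain ⟨e₂, he₂, h₂⟩ := Path.exists_expr p
    refine ⟨.concat e₁ e₂, by simp [PathExpr.vars, he₁, he₂], fun ν => ?_⟩
    rw [← List.singleton_append, ← h₁ ν, ← h₂ ν]
    rfl

end

theorem Runs.nil {N : ℕ} : Runs (D := D) N N [] fun _ _ => True :=
  fun I _ => ⟨I, rfl, fun _ _ => rfl, trivial⟩

/-- The translation of a constant or a relation name. -/
theorem compiles_nullary {n N : ℕ} {E : AlgExpr D Γ n} (hΓ : ∀ R ∈ Γ, R.id < N)
    {B : List (Clause D n)} (hB : B ≠ []) (hsafe : ∀ k, ∀ q ∈ B, (Clause.rule k q).Safe)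
    (huse : ∀ q ∈ B, ∀ L ∈ q.2, ∀ p, L.atom = .pred p → p.name ∈ Γ)
    (heval : ∀ I J, (∀ R ∈ Γ, J.rel R = I.rel R) → derivedBy B J = E.eval I) :
    ∃ k Q, Compiles E N k Q :=
  ⟨N, Runs.nil.compiles .nil le_rfl hΓ hB (hsafe N)
    (fun q hq L hL p hp => Or.inl (huse q hq L hL p hp)) fun I J h _ => heval I J h⟩

/-- The translation of a unary operator. -/
theorem Compiles.unary {m n N k : ℕ} {Q : List (Stratum D)} {E : AlgExpr D Γ m} {F : AlgExpr D Γ n}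
    (hE : Compiles E N k Q) (hΓ : ∀ R ∈ Γ, R.id < N) (q : Clause D n)
    (hsafe : ∀ k', (Clause.rule k' q).Safe)
    (huse : ∀ L ∈ q.2, ∀ p, L.atom = .pred p → p.name = ⟨k, m⟩)
    (heval : ∀ I J, J.rel ⟨k, m⟩ = E.eval I → derivedBy [q] J = F.eval I) :
    ∃ k Q, Compiles F N k Q := by
  obtain ⟨hNk, hL, hT, hR⟩ := hE
  refine ⟨k + 1, hR.compiles hL (by omega) hΓ (List.cons_ne_nil q []) (by simpa using hsafe _)
    ?_ fun I J _ => heval I J⟩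
  simp only [List.mem_singleton, forall_eq]
  intro L hL p hp
  rw [huse L hL p hp]
  exact Or.inr hT

/-- The translation of a binary operator. -/
theorem Compiles.binary {m n l N k₁ k₂ : ℕ} {Q₁ Q₂ : List (Stratum D)} {E₁ : AlgExpr D Γ m}
    {E₂ : AlgExpr D Γ n} {F : AlgExpr D Γ l} (h₁ : Compiles E₁ N k₁ Q₁)
    (h₂ : Compiles E₂ (k₁ + 1) k₂ Q₂) (hΓ : ∀ R ∈ Γ, R.id < N) {B : List (Clause D l)}
    (hB : B ≠ []) (hsafe : ∀ k', ∀ q ∈ B, (Clause.rule k' q).Safe)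
    (huse : ∀ q ∈ B, ∀ L ∈ q.2, ∀ p, L.atom = .pred p → p.name = ⟨k₁, m⟩ ∨ p.name = ⟨k₂, n⟩)
    (heval : ∀ I J, J.rel ⟨k₁, m⟩ = E₁.eval I → J.rel ⟨k₂, n⟩ = E₂.eval I →
      derivedBy B J = F.eval I) :
    ∃ k Q, Compiles F N k Q := by
  obtain ⟨hL, hR⟩ := h₁.append hΓ h₂
  have hle₁ := h₁.1
  have hle₂ := h₂.1
  refine ⟨k₂ + 1, hR.compiles hL (by omega) hΓ hB (hsafe _) (fun q hq L hL p hp => Or.inr ?_)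
    fun I J _ h => heval I J h.1 h.2⟩
  rw [headNames_append]
  rcases huse q hq L hL p hp with h | h
  · exact h ▸ Or.inl h₁.2.2.1
  · exact h ▸ Or.inr h₂.2.2.1

theorem ofTuple_cols [Nonempty D] {n : ℕ} (t : Tuple D n) :
    (fun i : Fin n => (ofTuple t).apply (.pvar i)) = t :=
  funext fun i => ofTuple_onPath t i

theorem mem_derivedBy_singleton {n : ℕ} {q : Clause D n} {J : Instance D} {u : Tuple D n} :
    u ∈ derivedBy [q] J ↔
      ∃ ν : Valuation D, (∀ L ∈ q.2, L.Sat J ν) ∧ u = fun i => ν.apply (q.1 i) := by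
  simp [derivedBy]

theorem Predicate.sat_of_eq {J : Instance D} {ν : Valuation D} {p : Predicate D}
    {t : Tuple D p.name.arity} (ht : t ∈ J.rel p.name) (h : ∀ i, ν.apply (p.args i) = t i) :
    p.Sat J ν := by
  rwa [Predicate.Sat, funext h]

theorem sat_cols_ofTuple [Nonempty D] {J : Instance D} {R : RelName} {t : Tuple D R.arity} :
    Predicate.Sat J (ofTuple t) (cols R) ↔ t ∈ J.rel R := by
  rw [Predicate.Sat]
  exact iff_of_eq (congrArg (· ∈ J.rel R) (ofTuple_cols t))

theorem Atom.name_eq_of_pred_eq {p p' : Predicate D} (h : Atom.pred p = .pred p') :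
    p'.name = p.name := by
  cases h
  rfl

/-- The arguments `x₀, …, xₙ₋₁` of a head. -/
def headCols (n : ℕ) : Fin n → Expr D := fun i => .pvar i

theorem lt_of_mem_vars_headCols {n : ℕ} {i : Fin n} {v : Var}
    (hv : v ∈ (headCols n i : Expr D).vars) : ∃ j < n, v = Sum.inr j :=
  ⟨i, i.2, hv⟩

theorem compiles_rel [Nonempty D] {N : ℕ} (hΓ : ∀ R ∈ Γ, R.id < N) {R : RelName} (hR : R ∈ Γ) :
    ∃ k Q, Compiles (D := D) (.rel R hR) N k Q := by
  refine compiles_nullary hΓ (B := [(headCols R.arity, [.pos (.pred (cols R))])]) (by simp)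
    ?_ ?_ fun I J h => ?_
  · simp only [List.mem_singleton, forall_eq]
    refine fun k => Clause.safe_of_cols (R := R) (by simp)
      (fun i v => lt_of_mem_vars_headCols) ?_
    simp only [List.mem_singleton, forall_eq]
    exact fun v => mem_vars_cols.1
  · simp only [List.mem_singleton, forall_eq]
    rintro p ⟨⟩
    exact hR
  · ext u
    rw [mem_derivedBy_singleton, AlgExpr.eval, ← h R hR]
    constructor
    · rintro ⟨ν, hν, rfl⟩
      exact hν (.pos (.pred (cols R))) (by simp)
    · refine fun hu => ⟨ofTuple u, ?_, (ofTuple_cols u).symm⟩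
      simp only [List.mem_singleton, forall_eq]
      exact sat_cols_ofTuple.2 hu

theorem compiles_const [Nonempty D] {n N : ℕ} (hΓ : ∀ R ∈ Γ, R.id < N)
    (C : Finset (Tuple D n)) : ∃ k Q, Compiles (Γ := Γ) (.const C) N k Q := by
  have hex (t : Tuple D n) (i : Fin n) := Path.exists_expr (t i)
  choose e he hval using hex
  refine compiles_nullary hΓ (B := (fun _ => .empty, [.neg (.eqn .empty .empty)]) ::
    C.toList.map fun t => (e t, [])) (by simp) ?_ ?_ fun I J h => ?_
  · intro k q hq
    rcases List.mem_cons.1 hq with rfl | hq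
    · exact Clause.safe_of_limited (fun i v hv => hv.elim) (by simp [Literal.atom, Atom.vars,
        PathExpr.vars])
    · obtain ⟨t, -, rfl⟩ := List.mem_map.1 hq
      exact Clause.safe_of_limited (fun i v hv => by simp [he] at hv) (by simp)
  · intro q hq L hL p hp
    rcases List.mem_cons.1 hq with rfl | hq
    · rw [List.mem_singleton.1 hL] at hp
      cases hp
    · obtain ⟨t, -, rfl⟩ := List.mem_map.1 hq
      simp at hL
  · ext u
    constructor
    · rintro ⟨q, hq, ν, hν, rfl⟩
      rcases List.mem_cons.1 hq with rfl | hq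
      · exact absurd rfl (hν (.neg (.eqn .empty .empty)) (by simp))
      · obtain ⟨t, ht, rfl⟩ := List.mem_map.1 hq
        simp only [hval]
        exact Finset.mem_toList.1 ht
    · intro hu
      refine ⟨(e u, []), List.mem_cons_of_mem _ (List.mem_map.2 ⟨u, Finset.mem_toList.2 hu, rfl⟩),
        ofTuple u, by simp, ?_⟩
      simp only [hval]

theorem Compiles.union [Nonempty D] {n N k₁ k₂ : ℕ} {Q₁ Q₂ : List (Stratum D)}
    {E F : AlgExpr D Γ n} (hΓ : ∀ R ∈ Γ, R.id < N) (h₁ : Compiles E N k₁ Q₁)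
    (h₂ : Compiles F (k₁ + 1) k₂ Q₂) : ∃ k Q, Compiles (.union E F) N k Q := by
  refine h₁.binary h₂ hΓ (B := [(headCols n, [.pos (.pred (cols ⟨k₁, n⟩))]),
    (headCols n, [.pos (.pred (cols ⟨k₂, n⟩))])]) (by simp) ?_ ?_ fun I J hE hF => ?_
  · have (k' k : ℕ) : (Clause.rule k' (headCols n,
        [.pos (.pred (cols (D := D) ⟨k, n⟩))])).Safe := by
      refine Clause.safe_of_cols (R := ⟨k, n⟩) (by simp) (fun i v => lt_of_mem_vars_headCols) ?_
      simp only [List.mem_singleton, forall_eq]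
      exact fun v => mem_vars_cols.1
    simp [this]
  · simp only [List.forall_mem_cons, List.mem_singleton, forall_eq]
    exact ⟨fun p hp => Or.inl (Atom.name_eq_of_pred_eq hp),
      fun p hp => Or.inr (Atom.name_eq_of_pred_eq hp)⟩
  · ext u
    rw [AlgExpr.eval, ← hE, ← hF]
    constructor
    · rintro ⟨q, hq, ν, hν, rfl⟩
      simp only [List.mem_cons, List.not_mem_nil, or_false] at hq
      rcases hq with rfl | rfl
      · exact Or.inl (hν (.pos (.pred (cols _))) (by simp))
      · exact Or.inr (hν (.pos (.pred (cols _))) (by simp))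
    · rintro (hu | hu)
      · refine ⟨_, List.mem_cons_self, ofTuple u, ?_, (ofTuple_cols u).symm⟩
        simp only [List.mem_singleton, forall_eq]
        exact sat_cols_ofTuple.2 hu
      · refine ⟨_, List.mem_cons_of_mem _ List.mem_cons_self, ofTuple u, ?_,
          (ofTuple_cols u).symm⟩
        simp only [List.mem_singleton, forall_eq]
        exact sat_cols_ofTuple.2 hu

theorem Compiles.diff [Nonempty D] {n N k₁ k₂ : ℕ} {Q₁ Q₂ : List (Stratum D)}
    {E F : AlgExpr D Γ n} (hΓ : ∀ R ∈ Γ, R.id < N) (h₁ : Compiles E N k₁ Q₁)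
    (h₂ : Compiles F (k₁ + 1) k₂ Q₂) : ∃ k Q, Compiles (.diff E F) N k Q := by
  refine h₁.binary h₂ hΓ (B := [(headCols n, [.pos (.pred (cols ⟨k₁, n⟩)),
    .neg (.pred (cols ⟨k₂, n⟩))])]) (by simp) ?_ ?_ fun I J hE hF => ?_
  · simp only [List.mem_singleton, forall_eq]
    refine fun k => Clause.safe_of_cols (R := ⟨k₁, n⟩) (by simp)
      (fun i v => lt_of_mem_vars_headCols) ?_
    simp only [List.forall_mem_cons]
    exact ⟨fun v => mem_vars_cols.1, fun v => mem_vars_cols.1, by simp⟩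
  · simp only [List.forall_mem_cons]
    exact ⟨⟨fun p hp => Or.inl (Atom.name_eq_of_pred_eq hp),
      fun p hp => Or.inr (Atom.name_eq_of_pred_eq hp), by simp⟩, by simp⟩
  · ext u
    rw [AlgExpr.eval, ← hE, ← hF, mem_derivedBy_singleton]
    constructor
    · rintro ⟨ν, hν, rfl⟩
      exact ⟨hν (.pos (.pred (cols _))) (by simp), hν (.neg (.pred (cols _))) (by simp)⟩
    · rintro ⟨hu, hu'⟩
      refine ⟨ofTuple u, ?_, (ofTuple_cols u).symm⟩
      simp only [List.forall_mem_cons]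
      refine ⟨?_, fun h => hu' ?_, by simp⟩
      · exact sat_cols_ofTuple.2 hu
      · exact sat_cols_ofTuple.1 h

theorem Compiles.prod [Nonempty D] {m n N k₁ k₂ : ℕ} {Q₁ Q₂ : List (Stratum D)}
    {E : AlgExpr D Γ m} {F : AlgExpr D Γ n} (hΓ : ∀ R ∈ Γ, R.id < N) (h₁ : Compiles E N k₁ Q₁)
    (h₂ : Compiles F (k₁ + 1) k₂ Q₂) : ∃ k Q, Compiles (.prod E F) N k Q := by
  let p : Predicate D := ⟨⟨k₂, n⟩, fun j => .pvar (m + j)⟩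
  have hp (v : Var) (hv : v ∈ p.vars) : ∃ j < n, v = Sum.inr (m + j) := by
    obtain ⟨j, hj⟩ := Set.mem_iUnion.1 hv
    exact ⟨j, j.2, hj⟩
  refine h₁.binary h₂ hΓ (B := [(headCols (m + n), [.pos (.pred (cols ⟨k₁, m⟩)),
    .pos (.pred p)])]) (by simp) ?_ ?_ fun I J hE hF => ?_
  · simp only [List.mem_singleton, forall_eq]
    intro k
    have hlim (j : ℕ) (hj : j < m + n) : (Clause.rule k (headCols (m + n),
        [.pos (.pred (cols (D := D) ⟨k₁, m⟩)), .pos (.pred p)])).Limited (Sum.inr j) := by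
      rcases lt_or_ge j m with h | h
      · exact .ofPred (cols ⟨k₁, m⟩) _ (by simp [Clause.rule]) (mem_vars_cols.2 ⟨j, h, rfl⟩)
      · refine .ofPred p _ (by simp [Clause.rule]) (Set.mem_iUnion.2 ⟨⟨j - m, ?_⟩, ?_⟩)
        · change j - m < n
          omega
        · change Sum.inr j = Sum.inr (m + (j - m))
          rw [Nat.add_sub_cancel' h]
    refine Clause.safe_of_limited (fun i v hv => ?_) ?_
    · obtain ⟨j, hj, rfl⟩ := lt_of_mem_vars_headCols hv
      exact hlim j hj
    · simp only [List.forall_mem_cons]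
      refine ⟨fun v hv => ?_, fun v hv => ?_, by simp⟩
      · obtain ⟨j, hj, rfl⟩ := mem_vars_cols.1 hv
        exact hlim j (Nat.lt_add_right n hj)
      · obtain ⟨j, hj, rfl⟩ := hp v hv
        exact hlim _ (Nat.add_lt_add_left hj m)
  · simp only [List.forall_mem_cons]
    exact ⟨⟨fun p hp => Or.inl (Atom.name_eq_of_pred_eq hp),
      fun p hp => Or.inr (Atom.name_eq_of_pred_eq hp), by simp⟩, by simp⟩
  · ext u
    rw [AlgExpr.eval, ← hE, ← hF, mem_derivedBy_singleton]
    constructor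
    · rintro ⟨ν, hν, rfl⟩
      refine ⟨fun i => ν.onPath i, hν (.pos (.pred (cols _))) (by simp),
        fun i => ν.onPath (m + i), hν (.pos (.pred p)) (by simp), ?_⟩
      funext i
      refine Fin.addCases (fun i => ?_) (fun i => ?_) i
      · rw [Fin.append_left]
        rfl
      · rw [Fin.append_right]
        rfl
    · rintro ⟨s, hs, t, ht, rfl⟩
      refine ⟨ofTuple (Fin.append s t), ?_, (ofTuple_cols _).symm⟩
      simp only [List.forall_mem_cons]
      refine ⟨?_, ?_, by simp⟩
      · refine Predicate.sat_of_eq (p := cols _) hs fun i => ?_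
        exact (ofTuple_onPath _ (Fin.castAdd n i)).trans (Fin.append_left s t i)
      · refine Predicate.sat_of_eq (p := p) ht fun i => ?_
        exact (ofTuple_onPath _ (Fin.natAdd m i)).trans (Fin.append_right s t i)

theorem Compiles.select [Nonempty D] {n N k : ℕ} {Q : List (Stratum D)} {E : AlgExpr D Γ n}
    (hΓ : ∀ R ∈ Γ, R.id < N) (h : Compiles E N k Q) (α β : ColExpr D n) :
    ∃ k Q, Compiles (.select α β E) N k Q := by
  refine h.unary hΓ (headCols n, [.pos (.pred (cols ⟨k, n⟩)), .pos (.eqn (toExpr α) (toExpr β))])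
    (fun k' => Clause.safe_of_cols (R := ⟨k, n⟩) (by simp) (fun i v => lt_of_mem_vars_headCols) ?_)
    ?_ fun I J hE => ?_
  · simp only [List.forall_mem_cons]
    exact ⟨fun v => mem_vars_cols.1,
      fun v hv => hv.elim lt_of_mem_vars_toExpr lt_of_mem_vars_toExpr, by simp⟩
  · simp only [List.forall_mem_cons]
    exact ⟨fun p hp => Atom.name_eq_of_pred_eq hp,
      fun p hp => by simp [Literal.atom] at hp, by simp⟩
  · ext u
    rw [AlgExpr.eval, ← hE, mem_derivedBy_singleton]
    have hsat (ν : Valuation D) : Literal.Sat J ν (.pos (.eqn (toExpr α) (toExpr β))) ↔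
        (α.apply fun i => ν.onPath i) = β.apply fun i => ν.onPath i := by
      rw [← apply_toExpr, ← apply_toExpr]
      rfl
    constructor
    · rintro ⟨ν, hν, rfl⟩
      exact ⟨hν (.pos (.pred (cols _))) (by simp), (hsat ν).1 (hν _ (by simp))⟩
    · rintro ⟨hu, hu'⟩
      refine ⟨ofTuple u, ?_, (ofTuple_cols u).symm⟩
      simp only [List.forall_mem_cons, hsat, ofTuple_onPath]
      exact ⟨sat_cols_ofTuple.2 hu, hu', by simp⟩

theorem Compiles.project [Nonempty D] {n p N k : ℕ} {Q : List (Stratum D)} {E : AlgExpr D Γ n}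
    (hΓ : ∀ R ∈ Γ, R.id < N) (h : Compiles E N k Q) (α : Fin p → ColExpr D n) :
    ∃ k Q, Compiles (.project α E) N k Q := by
  refine h.unary hΓ (fun j => toExpr (α j), [.pos (.pred (cols ⟨k, n⟩))])
    (fun k' => Clause.safe_of_cols (R := ⟨k, n⟩) (by simp) (fun i v => lt_of_mem_vars_toExpr) ?_)
    ?_ fun I J hE => ?_
  · simp only [List.mem_singleton, forall_eq]
    exact fun v => mem_vars_cols.1
  · simp only [List.mem_singleton, forall_eq]
    exact fun p hp => Atom.name_eq_of_pred_eq hp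
  · ext u
    rw [AlgExpr.eval, ← hE, mem_derivedBy_singleton]
    simp only [apply_toExpr]
    constructor
    · rintro ⟨ν, hν, rfl⟩
      exact ⟨_, hν (.pos (.pred (cols _))) (by simp), rfl⟩
    · rintro ⟨t, ht, rfl⟩
      refine ⟨ofTuple t, ?_, by simp only [ofTuple_onPath]⟩
      simp only [List.mem_singleton, forall_eq]
      exact sat_cols_ofTuple.2 ht

theorem Compiles.unpack [Nonempty D] {n N k : ℕ} {Q : List (Stratum D)} {E : AlgExpr D Γ n}
    (hΓ : ∀ R ∈ Γ, R.id < N) (h : Compiles E N k Q) (i : Fin n) :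
    ∃ k Q, Compiles (.unpack i E) N k Q := by
  let p : Predicate D := ⟨⟨k, n⟩, fun j : Fin n => if j = i then .pack (.pvar j) else .pvar j⟩
  have hpv (j : Fin n) : (p.args j).vars = {Sum.inr j.1} := by
    simp only [p]
    split <;> rfl
  have hpa (ν : Valuation D) : (fun j => ν.apply (p.args j)) = fun j : Fin n =>
      if j = i then [Value.pack (ν.onPath j)] else ν.onPath j := by
    funext j
    simp only [p]
    split <;> rfl
  refine h.unary hΓ (headCols n, [.pos (.pred p)]) (fun k' => Clause.safe_of_limited
    (fun j v hv => ?_) ?_) ?_ fun I J hE => ?_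
  · refine .ofPred p v (by simp [Clause.rule]) (Set.mem_iUnion.2 ⟨j, ?_⟩)
    rw [hpv]
    exact hv
  · simp only [List.mem_singleton, forall_eq]
    exact fun v hv => .ofPred p v (by simp [Clause.rule]) hv
  · simp only [List.mem_singleton, forall_eq]
    exact fun p hp => Atom.name_eq_of_pred_eq hp
  · ext u
    rw [AlgExpr.eval, ← hE, mem_derivedBy_singleton]
    simp only [List.mem_singleton, forall_eq, Literal.Sat, Atom.Sat, Predicate.Sat, hpa]
    constructor
    · rintro ⟨ν, hν, rfl⟩
      refine ⟨_, hν, ν.onPath i, by simp, ?_⟩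
      funext j
      by_cases hj : j = i
      · subst hj
        simp [headCols, Valuation.apply, PathExpr.eval]
      · simp [headCols, Valuation.apply, PathExpr.eval, hj]
    · rintro ⟨t, ht, s, hs, rfl⟩
      refine ⟨ofTuple (Function.update t i s), ?_, (ofTuple_cols _).symm⟩
      convert ht using 1
      funext j
      rw [ofTuple_onPath]
      by_cases hj : j = i
      · subst hj
        simp [hs]
      · simp [hj]

theorem Compiles.sub [Nonempty D] {n N k : ℕ} {Q : List (Stratum D)} {E : AlgExpr D Γ n}
    (hΓ : ∀ R ∈ Γ, R.id < N) (h : Compiles E N k Q) (i : Fin n) :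
    ∃ k Q, Compiles (.sub i E) N k Q := by
  let e : Expr D := .concat (.concat (.pvar (n + 1)) (.pvar n)) (.pvar (n + 2))
  have he (v : Var) : v ∈ e.vars ↔ v = Sum.inr (n + 1) ∨ v = Sum.inr n ∨ v = Sum.inr (n + 2) := by
    simp only [e, PathExpr.vars, Set.mem_union, Set.mem_singleton_iff, or_assoc]
  refine h.unary hΓ (headCols (n + 1), [.pos (.pred (cols ⟨k, n⟩)), .pos (.eqn (.pvar i) e)])
    (fun k' => ?_) ?_ fun I J hE => ?_
  · have hlim (j : ℕ) (hj : j < n) : (Clause.rule k' (headCols (n + 1),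
        [.pos (.pred (cols ⟨k, n⟩)), .pos (.eqn (.pvar i) e)])).Limited (Sum.inr j) :=
      .ofPred (cols ⟨k, n⟩) _ (by simp [Clause.rule]) (mem_vars_cols.2 ⟨j, hj, rfl⟩)
    have hlim' (v : Var) (hv : v ∈ e.vars) : (Clause.rule k' (headCols (n + 1),
        [.pos (.pred (cols ⟨k, n⟩)), .pos (.eqn (.pvar i) e)])).Limited v := by
      refine .ofLeft (.pvar i) e v (by simp [Clause.rule]) ?_ hv
      rintro w ⟨⟩
      exact hlim i i.2
    refine Clause.safe_of_limited (fun j v hv => ?_) ?_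
    · obtain ⟨j, hj, rfl⟩ := lt_of_mem_vars_headCols hv
      rcases Nat.lt_succ_iff_lt_or_eq.1 hj with hj | rfl
      · exact hlim j hj
      · exact hlim' _ ((he _).2 (Or.inr (Or.inl rfl)))
    · simp only [List.forall_mem_cons]
      refine ⟨fun v hv => ?_, fun v hv => ?_, by simp⟩
      · obtain ⟨j, hj, rfl⟩ := mem_vars_cols.1 hv
        exact hlim j hj
      · rcases hv with hv | hv
        · cases hv
          exact hlim i i.2
        · exact hlim' v hv
  · simp only [List.forall_mem_cons]
    exact ⟨fun p hp => Atom.name_eq_of_pred_eq hp,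
      fun p hp => by simp [Literal.atom] at hp, by simp⟩
  · ext u
    rw [AlgExpr.eval, ← hE, mem_derivedBy_singleton]
    constructor
    · rintro ⟨ν, hν, rfl⟩
      have heq : ν.onPath i = ν.onPath (n + 1) ++ ν.onPath n ++ ν.onPath (n + 2) :=
        hν (.pos (.eqn (.pvar i) e)) (by simp)
      refine ⟨fun j => ν.onPath j, hν (.pos (.pred (cols _))) (by simp), ν.onPath n,
        ⟨_, _, heq.symm⟩, ?_⟩
      funext j
      refine Fin.lastCases ?_ (fun j => ?_) j
      · rw [Fin.snoc_last]
        rfl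
      · rw [Fin.snoc_castSucc]
        rfl
    · rintro ⟨t, ht, s, ⟨a, b, hab⟩, rfl⟩
      let ν : Valuation D := ⟨fun _ => Classical.arbitrary D, fun j => if h : j < n then t ⟨j, h⟩
        else if j = n then s else if j = n + 1 then a else b⟩
      have hν (j : Fin n) : ν.onPath j = t j := by simp [ν]
      refine ⟨ν, ?_, ?_⟩
      · simp only [List.forall_mem_cons]
        refine ⟨?_, ?_, by simp⟩
        · exact Predicate.sat_of_eq (p := cols _) ht hν
        · change ν.onPath i = ν.onPath (n + 1) ++ ν.onPath n ++ ν.onPath (n + 2)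
          rw [hν, ← hab]
          simp [ν]
      · funext j
        refine Fin.lastCases ?_ (fun j => ?_) j
        · rw [Fin.snoc_last]
          simp [ν, headCols, Valuation.apply, PathExpr.eval]
        · rw [Fin.snoc_castSucc]
          exact (hν j).symm

theorem AlgExpr.exists_compiles [Nonempty D] {n : ℕ} (E : AlgExpr D Γ n) :
    ∀ N, (∀ R ∈ Γ, R.id < N) → ∃ k Q, Compiles E N k Q := by
  have binary {l m n : ℕ} {E : AlgExpr D Γ l} {F : AlgExpr D Γ m} {G : AlgExpr D Γ n}
      (ihE : ∀ N, (∀ R ∈ Γ, R.id < N) → ∃ k Q, Compiles E N k Q)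
      (ihF : ∀ N, (∀ R ∈ Γ, R.id < N) → ∃ k Q, Compiles F N k Q) {N : ℕ}
      (hΓ : ∀ R ∈ Γ, R.id < N) (h : ∀ {k₁ k₂ Q₁ Q₂}, Compiles E N k₁ Q₁ →
        Compiles F (k₁ + 1) k₂ Q₂ → ∃ k Q, Compiles G N k Q) : ∃ k Q, Compiles G N k Q := by
    obtain ⟨k₁, Q₁, h₁⟩ := ihE N hΓ
    obtain ⟨k₂, Q₂, h₂⟩ := ihF (k₁ + 1) fun R hR => by have := hΓ R hR; have := h₁.1; omega
    exact h h₁ h₂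
  induction E with
  | rel R hR => exact fun N hΓ => compiles_rel hΓ hR
  | const C => exact fun N hΓ => compiles_const hΓ C
  | union E F ihE ihF => exact fun N hΓ => binary ihE ihF hΓ fun h₁ h₂ => h₁.union hΓ h₂
  | diff E F ihE ihF => exact fun N hΓ => binary ihE ihF hΓ fun h₁ h₂ => h₁.diff hΓ h₂
  | prod E F ihE ihF => exact fun N hΓ => binary ihE ihF hΓ fun h₁ h₂ => h₁.prod hΓ h₂
  | select α β E ih =>
    intro N hΓ
    obtain ⟨k, Q, h⟩ := ih N hΓ
    exact h.select hΓ α β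
  | project α E ih =>
    intro N hΓ
    obtain ⟨k, Q, h⟩ := ih N hΓ
    exact h.project hΓ α
  | unpack i E ih =>
    intro N hΓ
    obtain ⟨k, Q, h⟩ := ih N hΓ
    exact h.unpack hΓ i
  | sub i E ih =>
    intro N hΓ
    obtain ⟨k, Q, h⟩ := ih N hΓ
    exact h.sub hΓ i

/-- Algebra expressions are expressible by nonrecursive programs. -/
theorem AlgExpr.exists_program [Nonempty D] {n : ℕ} (E : AlgExpr D Γ n) :
    ∃ P : Program D, P.Over Γ ∧ P.Nonrecursive ∧ ∃ k : ℕ, (⟨k, n⟩ : RelName) ∈ P.idb ∧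
      ∀ I : Instance D, I.Over Γ → ∃ J : Instance D, P.IsResult I J ∧
        J.rel ⟨k, n⟩ = E.eval I := by
  have hΓ (R) (hR : R ∈ Γ) : R.id < Γ.sup RelName.id + 1 :=
    Nat.lt_succ_of_le (Finset.le_sup (f := RelName.id) hR)
  obtain ⟨k, Q, -, hL, ⟨S, hS, r, hr, hT⟩, hR⟩ := E.exists_compiles _ hΓ
  have hout (R : RelName) (h : Γ.sup RelName.id + 1 ≤ R.id) : R ∉ Γ :=
    fun hR => (hΓ R hR).not_ge h
  refine ⟨⟨Q, hL.safe, hL.stratified⟩, ⟨?_, ?_⟩, fun R hR => ?_, k, ⟨r, ⟨S, hS, hr⟩, hT⟩,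
    fun I hI => ?_⟩
  · rintro R ⟨⟨r, ⟨S, hS, hr⟩, hu⟩, hidb⟩
    refine (hL.closed S hS r hr R hu).resolve_right ?_
    rintro ⟨S', hS', r', hr', h⟩
    exact hidb ⟨r', ⟨S', hS', hr'⟩, h⟩
  · rintro _ ⟨r, ⟨S, hS, hr⟩, rfl⟩
    exact hout _ (hL.bounds S hS r hr).1
  · have hlt {R₁ R₂ : RelName} (h : Relation.TransGen
        (Program.DependsOn ⟨Q, hL.safe, hL.stratified⟩) R₁ R₂) : R₂.id < R₁.id := by
      have step {R₁ R₂ : RelName} (h : Program.DependsOn ⟨Q, hL.safe, hL.stratified⟩ R₁ R₂) :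
          R₂.id < R₁.id := by
        obtain ⟨-, -, r, ⟨S, hS, hr⟩, rfl, hu⟩ := h
        exact hL.lt S hS r hr _ hu
      induction h with
      | single h => exact step h
      | tail _ h ih => exact (step h).trans ih
    exact lt_irrefl _ (hlt hR)
  · obtain ⟨J, hJ, -, hE⟩ := hR I fun R h => hI R (hout R h)
    exact ⟨J, hJ, hE⟩

end SeqDatalog

theorem mainTheorem10 {D : Type*} [Countable D] [Infinite D] (Γ : SeqDatalog.Schema) :
    (∀ P : SeqDatalog.Program D, P.Over Γ → P.Nonrecursive →
      ∀ T ∈ P.idb, ∃ E : SeqDatalog.AlgExpr D Γ T.arity,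
        ∀ I : SeqDatalog.Instance D, I.Over Γ →
          ∃ J : SeqDatalog.Instance D, P.IsResult I J ∧ J.rel T = E.eval I) ∧
    (∀ (n : ℕ) (E : SeqDatalog.AlgExpr D Γ n),
      ∃ P : SeqDatalog.Program D, P.Over Γ ∧ P.Nonrecursive ∧
        ∃ k : ℕ, (⟨k, n⟩ : SeqDatalog.RelName) ∈ P.idb ∧
          ∀ I : SeqDatalog.Instance D, I.Over Γ →
            ∃ J : SeqDatalog.Instance D, P.IsResult I J ∧
              J.rel ⟨k, n⟩ = E.eval I) :=
  ⟨fun _ _ hP T _ => hP.exists_algExpr T, fun _ E => E.exists_program⟩
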